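/- **Setting.** Consider the isomonodromy equation for a $3\times 3$ matrix function $\Phi(u)$, $u=(u_1,u_2,u_3)$ with distinct entries, $$\frac{\partial \Phi}{\partial u_k}=[\mathrm{ad}_u^{-1}\mathrm{ad}_{E_k}\Phi,\Phi],\qquad k=1,2,3,$$ where $E_k$ is the diagonal matrix unit, and $(\mathrm{ad}_u^{-1}A)_{ij}=A_{ij}/(u_i-u_j)$ for $i\ne j$, $(\mathrm{ad}_u^{-1}A)_{ii}=0$. Put $z_1=u_1$, $z_2=(u_2-u_1)/u_1$, $z_3=(u_3-u_2)/(u_2-u_1)$; all functions are considered on the logarithmic covering, i.e. as functions of $\log z_1,\log z_2,\log z_3$. Let $\delta_kA$ be the matrix obtained from $A$ by keeping the upper left $k\times k$ block and the diagonal, and $z^{\mathrm{ad}X}Y=z^XYz^{-X}$. Let $\Phi_0=(\varphi_{ij})$ be a constant $3\times3$ matrix such that the eigenvalues of its upper left $2\times 2$ block satisfy $|\mathrm{Re}(\lambda^{(2)}_i-\lambda^{(2)}_j)|<1$. Let $\Phi=\Phi_3(u;\Phi_0)$ be the shrinking solution with boundary value $\Phi_0$: a solution of the equation, defined for $|z_3|$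 large (locally uniformly in $\arg z_3$), for which there are matrix functions $\Phi_2(z_1,z_2)$, $\Phi_1(z_1)$ such that, with $\Phi_3=\Phi$ and for $k=3,2,1$, as $z_k\to\infty$ with $\arg z_k$ bounded, $$\delta_{k-1}\Phi_k\to\delta_{k-1}\Phi_{k-1},\qquad z_k^{\mathrm{ad}\,\delta_{k-1}\Phi_{k-1}}\Phi_k\to\Phi_{k-1}.$$ Let $\lambda_1,\lambda_2,\lambda_3$ be the eigenvalues of $\Phi$ (they are constant), in any order, and $$\theta_\infty=\lambda_1-\lambda_2,\qquad \theta_i=\lambda_3-\varphi_{ii}\quad(i=1,2,3).$$ Let $\sigma=\lambda^{(2)}_1-\lambda^{(2)}_2$ be the difference of the eigenvalues of the upper left $2\times2$ block of $\Phi_0$, ordered so that $0<\mathrm{Re}\,\sigma<1$, and suppose $\sigma\neq\theta_\infty+\theta_3$ and $\sigma\ne\theta_\infty-\theta_3$. Define $J$ by $$(-\theta_3+\theta_\infty-\sigma)(\theta_3+\theta_\infty-\sigma)J=\varphi_{13}\varphi_{31}+\frac{2(\varphi_{13}\varphi_{32}\varphi_{21}-\varphi_{12}\varphi_{23}\varphi_{31})}{\sigma}-\frac{((\varphi_{11}-\varphi_{22})\varphi_{13}+2\varphi_{12}\varphi_{23})((\varphi_{11}-\varphi_{22})\varphi_{31}+2\varphi_{32}\varphi_{21})}{\sigma^2}$$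 and suppose $J\neq0$. Define $$y=\frac{x}{x+(1-x)R},\qquad x=\frac{u_2-u_1}{u_3-u_1},\qquad R=\frac1v\left(\lambda_3-\Phi_{33}+\frac{\Phi_{13}\Phi_{31}-(\lambda_3-\Phi_{11})(\lambda_3-\Phi_{33})}{\lambda_3-\Phi_{11}+v}\right),$$ $$v=\frac{\Phi_{12}\Phi_{23}\Phi_{31}+(\lambda_2-\Phi_{22})\Phi_{13}\Phi_{31}}{(\lambda_2-\Phi_{11})(\lambda_2-\Phi_{22})-\Phi_{12}\Phi_{21}}.$$ **Proposition 1.1.** The function $y$ depends only on $x$ (more precisely on $\log x$, for the branch with $\log x+\log z_3\to0$ as $z_3\to\infty$). For $x$ near $0$ in any sector $|\arg x|\le M$ no denominator above vanishes, and $y(x)$ is holomorphic, different from $0,1,x$, and satisfies the Painlevé VI equation $$y''=\tfrac12\Big(\tfrac1y+\tfrac1{y-1}+\tfrac1{y-x}\Big)y'^2-\Big(\tfrac1x+\tfrac1{x-1}+\tfrac1{y-x}\Big)y'+\frac{y(y-1)(y-x)}{x^2(x-1)^2}\Big(\alpha+\beta\frac{x}{y^2}+\gamma\frac{x-1}{(y-1)^2}+\delta\frac{x(x-1)}{(y-x)^2}\Big)$$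 with $\alpha=\frac{(\theta_\infty-1)^2}2$, $\beta=-\frac{\theta_1^2}2$, $\gamma=\frac{\theta_3^2}2$, $\delta=\frac{1-\theta_2^2}2$. As $x\to0$ in any such sector, $$y(x)=J\,x^{1-\sigma}+o(x^{1-\sigma}).$$ -/

import Mathlib

open Filter Topology Asymptotics

namespace Isomonodromy

noncomputable section

/-! ### The isomonodromy equation -/

/-- The operator `ad_u⁻¹`: divide the `(i,j)` entry by `u i - u j` off the diagonal,
and set the diagonal to zero. -/
def adInv {n : ℕ} (u : Fin n → ℂ) (A : Matrix (Fin n) (Fin n) ℂ) : Matrix (Fin n) (Fin n) ℂ :=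
  Matrix.of fun i j => if i = j then 0 else A i j / (u i - u j)

/-- The commutator `[A, B] = A B - B A`. -/
def comm {n : ℕ} (A B : Matrix (Fin n) (Fin n) ℂ) : Matrix (Fin n) (Fin n) ℂ :=
  A * B - B * A

/-- The right-hand side `[ad_u⁻¹ ad_{E_k} Φ, Φ]` of the equation for `∂Φ/∂u_k`,
where `E_k` is the diagonal matrix unit. -/
def isoRHS {n : ℕ} (u : Fin n → ℂ) (A : Matrix (Fin n) (Fin n) ℂ) (k : Fin n) :
    Matrix (Fin n) (Fin n) ℂ :=
  comm (adInv u (comm (Matrix.single k k 1) A)) A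

/-- Solutions are multivalued in `u`.  They are described on a covering, with coordinates
`ζ_k = log z_k`, where `z_1 = u_1`, `z_2 = (u_2 - u_1)/u_1` and
`z_k = (u_k - u_{k-1})/(u_{k-1} - u_{k-2})` for larger `k`
(that is, `u_0 = 0` and `u_{-1} = -1`).
Hence `u_k = z_1 + z_1 z_2 + ... + z_1 z_2 ⋯ z_k`. -/
def uOfLog {n : ℕ} (ζ : Fin n → ℂ) (k : Fin n) : ℂ :=
  ∑ i ∈ Finset.Iic k, ∏ j ∈ Finset.Iic i, Complex.exp (ζ j)

/-- `Φ` is a holomorphic solution on `W` (a set of logarithmic coordinates, lying over the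
complement of the fat diagonal) of the system `∂Φ/∂u_k = [ad_u⁻¹ ad_{E_k} Φ, Φ]` for all `k`,
i.e. `dΦ = ∑ k, [ad_u⁻¹ ad_{E_k} Φ, Φ] du_k`, pulled back to the logarithmic coordinates. -/
def IsIsomonodromySolutionOn {n : ℕ} (W : Set (Fin n → ℂ))
    (Φ : (Fin n → ℂ) → Matrix (Fin n) (Fin n) ℂ) : Prop :=
  ∀ ζ ∈ W, Function.Injective (uOfLog ζ) ∧
    ∀ i j : Fin n, HasFDerivAt (fun η => Φ η i j)
      (∑ k : Fin n, (isoRHS (uOfLog ζ) (Φ ζ) k i j) •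
        fderiv ℂ (fun η : Fin n → ℂ => uOfLog η k) ζ) ζ

/-! ### Shrinking solutions for `n = 3` -/

/-- `δ_k A`: keep the upper left `k × k` block and the diagonal (indices start at `0`). -/
def deltaUL {n : ℕ} (k : ℕ) (A : Matrix (Fin n) (Fin n) ℂ) : Matrix (Fin n) (Fin n) ℂ :=
  Matrix.of fun i j => if ((i : ℕ) < k ∧ (j : ℕ) < k) ∨ i = j then A i j else 0

/-- `z^{ad X} Y = z^X Y z^{-X}` for `z = e^ζ`. -/
def expAd {n : ℕ} (ζ : ℂ) (X Y : Matrix (Fin n) (Fin n) ℂ) : Matrix (Fin n) (Fin n) ℂ :=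
  NormedSpace.exp (ζ • X) * Y * NormedSpace.exp (-(ζ • X))

/-- `z = e^ζ → ∞` with `|arg z| ≤ M`. -/
def logAtInfty (M : ℝ) : Filter ℂ :=
  comap Complex.re atTop ⊓ 𝓟 {ζ | |ζ.im| ≤ M}

/-- `x = e^ξ → 0` with `|arg x| ≤ M`. -/
def logAtZero (M : ℝ) : Filter ℂ :=
  comap Complex.re atBot ⊓ 𝓟 {ξ | |ξ.im| ≤ M}

/-- The neighbourhood of `z_3 = ∞` given by `log |z_3| > ρ (arg z_3)`, on the logarithmic
covering; `z_1` and `z_2` are arbitrary. -/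
def logDomain (ρ : ℝ → ℝ) : Set (Fin 3 → ℂ) :=
  {ζ | ρ (ζ 2).im < (ζ 2).re}

/-- `Φ` is the shrinking solution `Φ_3(u; Φ₀)` of the third isomonodromy equation with boundary
value `Φ₀`, on `logDomain ρ`. -/
structure IsShrinkingSolution (Φ₀ : Matrix (Fin 3) (Fin 3) ℂ) (ρ : ℝ → ℝ)
    (Φ : (Fin 3 → ℂ) → Matrix (Fin 3) (Fin 3) ℂ) : Prop where
  /-- The boundary condition on the eigenvalues of the upper left `2 × 2` block; for the
  `1 × 1` block it is empty. -/
  boundary : ∀ a ∈ (Φ₀.submatrix Fin.castSucc Fin.castSucc).charpoly.roots,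
    ∀ b ∈ (Φ₀.submatrix Fin.castSucc Fin.castSucc).charpoly.roots, |(a - b).re| < 1
  solution : IsIsomonodromySolutionOn (logDomain ρ) Φ
  /-- The regularized limits `Φ = Φ_3 → Φ_2 → Φ_1 → Φ₀` as `z_3`, `z_2`, `z_1` tend to `∞`. -/
  limits : ∃ (Φ₂ : ℂ → ℂ → Matrix (Fin 3) (Fin 3) ℂ) (Φ₁ : ℂ → Matrix (Fin 3) (Fin 3) ℂ),
    ∀ M : ℝ,
      (∀ ζ₁ ζ₂ : ℂ,
        Tendsto (fun ζ₃ => deltaUL 2 (Φ ![ζ₁, ζ₂, ζ₃])) (logAtInfty M)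
          (𝓝 (deltaUL 2 (Φ₂ ζ₁ ζ₂))) ∧
        Tendsto (fun ζ₃ => expAd ζ₃ (deltaUL 2 (Φ₂ ζ₁ ζ₂)) (Φ ![ζ₁, ζ₂, ζ₃])) (logAtInfty M)
          (𝓝 (Φ₂ ζ₁ ζ₂))) ∧
      (∀ ζ₁ : ℂ,
        Tendsto (fun ζ₂ => deltaUL 1 (Φ₂ ζ₁ ζ₂)) (logAtInfty M) (𝓝 (deltaUL 1 (Φ₁ ζ₁))) ∧
        Tendsto (fun ζ₂ => expAd ζ₂ (deltaUL 1 (Φ₁ ζ₁)) (Φ₂ ζ₁ ζ₂)) (logAtInfty M)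
          (𝓝 (Φ₁ ζ₁))) ∧
      Tendsto (fun ζ₁ => deltaUL 0 (Φ₁ ζ₁)) (logAtInfty M) (𝓝 (deltaUL 0 Φ₀)) ∧
      Tendsto (fun ζ₁ => expAd ζ₁ (deltaUL 0 Φ₀) (Φ₁ ζ₁)) (logAtInfty M) (𝓝 Φ₀)

/-! ### From the isomonodromy equation to Painlevé VI -/

/-- `x = (u_2 - u_1)/(u_3 - u_1)`. -/
def xOf (ζ : Fin 3 → ℂ) : ℂ :=
  (uOfLog ζ 1 - uOfLog ζ 0) / (uOfLog ζ 2 - uOfLog ζ 0)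

/-- The branch of `log x` used throughout.  Since `x = 1/(1 + z_3)`, it is
`-log z_3 - log (1 + 1/z_3)`, with the last logarithm small for large `z_3`. -/
def logX (ζ : Fin 3 → ℂ) : ℂ :=
  -ζ 2 - Complex.log (1 + Complex.exp (-ζ 2))

theorem exp_logX (ζ : Fin 3 → ℂ) (h : Function.Injective (uOfLog ζ)) :
    Complex.exp (logX ζ) = xOf ζ := by
  have h0 : uOfLog ζ 0 = Complex.exp (ζ 0) := by
    have e : Finset.Iic (0 : Fin 3) = {0} := by decide
    simp [uOfLog, e]
  have h1 : uOfLog ζ 1 = Complex.exp (ζ 0) + Complex.exp (ζ 0) * Complex.exp (ζ 1) := by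
    have e : Finset.Iic (0 : Fin 3) = {0} := by decide
    have e' : Finset.Iic (1 : Fin 3) = {0, 1} := by decide
    simp [uOfLog, e, e']
  have h2 : uOfLog ζ 2 = Complex.exp (ζ 0) + (Complex.exp (ζ 0) * Complex.exp (ζ 1) +
      Complex.exp (ζ 0) * (Complex.exp (ζ 1) * Complex.exp (ζ 2))) := by
    have e : Finset.Iic (0 : Fin 3) = {0} := by decide
    have e' : Finset.Iic (1 : Fin 3) = {0, 1} := by decide
    have e'' : Finset.Iic (2 : Fin 3) = {0, 1, 2} := by decide
    have n1 : (0 : Fin 3) ∉ ({1, 2} : Finset (Fin 3)) := by decide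
    have n2 : (1 : Fin 3) ∉ ({2} : Finset (Fin 3)) := by decide
    simp only [uOfLog, e'', Finset.sum_insert n1, Finset.sum_insert n2, Finset.sum_singleton, e,
      e', Finset.prod_insert n1, Finset.prod_insert n2, Finset.prod_singleton]
    simp
  have hne : uOfLog ζ 2 ≠ uOfLog ζ 0 := fun hh => absurd (h hh) (by decide)
  have hz : 1 + Complex.exp (ζ 2) ≠ 0 := by
    intro hh
    apply hne
    rw [h2, h0]
    linear_combination Complex.exp (ζ 0) * Complex.exp (ζ 1) * hh
  have e0 := Complex.exp_ne_zero (ζ 0)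
  have e1 := Complex.exp_ne_zero (ζ 1)
  have e2 := Complex.exp_ne_zero (ζ 2)
  have hw : 1 + Complex.exp (-ζ 2) ≠ 0 := by
    rw [Complex.exp_neg]
    intro hh
    apply hz
    field_simp at hh
    linear_combination hh
  rw [logX, Complex.exp_sub, Complex.exp_log hw, xOf, h0, h1, h2, Complex.exp_neg]
  have hz' : Complex.exp (ζ 2) + 1 ≠ 0 := by rwa [add_comm]
  field_simp
  ring

/-- The denominator of the auxiliary quantity `v`. -/
def harnadD (l : Fin 3 → ℂ) (A : Matrix (Fin 3) (Fin 3) ℂ) : ℂ :=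
  (l 1 - A 0 0) * (l 1 - A 1 1) - A 0 1 * A 1 0

/-- The auxiliary quantity `v`; here `l 0, l 1, l 2` are the eigenvalues
`λ_1, λ_2, λ_3` of `A`. -/
def harnadV (l : Fin 3 → ℂ) (A : Matrix (Fin 3) (Fin 3) ℂ) : ℂ :=
  (A 0 1 * A 1 2 * A 2 0 + (l 1 - A 1 1) * A 0 2 * A 2 0) / harnadD l A

/-- The quantity `R`. -/
def harnadR (l : Fin 3 → ℂ) (A : Matrix (Fin 3) (Fin 3) ℂ) : ℂ :=
  1 / harnadV l A * (l 2 - A 2 2 +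
    (A 0 2 * A 2 0 - (l 2 - A 0 0) * (l 2 - A 2 2)) / (l 2 - A 0 0 + harnadV l A))

/-- `y = x / (x + (1 - x) R)`. -/
def harnadY (l : Fin 3 → ℂ) (A : Matrix (Fin 3) (Fin 3) ℂ) (x : ℂ) : ℂ :=
  x / (x + (1 - x) * harnadR l A)

/-- No denominator in the definition of `y` vanishes. -/
def HarnadDefined (l : Fin 3 → ℂ) (A : Matrix (Fin 3) (Fin 3) ℂ) (x : ℂ) : Prop :=
  harnadD l A ≠ 0 ∧ harnadV l A ≠ 0 ∧ l 2 - A 0 0 + harnadV l A ≠ 0 ∧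
    x + (1 - x) * harnadR l A ≠ 0

/-- `d/dx` for a function of `ξ = log x`. -/
def ddx (f : ℂ → ℂ) (ξ : ℂ) : ℂ := Complex.exp (-ξ) * deriv f ξ

/-- The multivalued function `y(x) = Y(log x)` is holomorphic at the point `x = e^ξ` of the
logarithmic covering, takes none of the values `0, 1, x` there, and satisfies the sixth
Painlevé equation with parameters `α, β, γ, δ` there. -/
def IsPainleveSixAt (α β γ δ : ℂ) (Y : ℂ → ℂ) (ξ : ℂ) : Prop :=
  AnalyticAt ℂ Y ξ ∧ Complex.exp ξ ≠ 1 ∧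
  Y ξ ≠ 0 ∧ Y ξ ≠ 1 ∧ Y ξ ≠ Complex.exp ξ ∧
  ddx (ddx Y) ξ =
    1 / 2 * (1 / Y ξ + 1 / (Y ξ - 1) + 1 / (Y ξ - Complex.exp ξ)) * ddx Y ξ ^ 2
    - (1 / Complex.exp ξ + 1 / (Complex.exp ξ - 1) + 1 / (Y ξ - Complex.exp ξ)) * ddx Y ξ
    + Y ξ * (Y ξ - 1) * (Y ξ - Complex.exp ξ) /
        (Complex.exp ξ ^ 2 * (Complex.exp ξ - 1) ^ 2) *
      (α + β * (Complex.exp ξ / Y ξ ^ 2) + γ * ((Complex.exp ξ - 1) / (Y ξ - 1) ^ 2)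
        + δ * (Complex.exp ξ * (Complex.exp ξ - 1) / (Y ξ - Complex.exp ξ) ^ 2))

end

end Isomonodromy

/-!
The shrinking solution depends on `z₁` and `z₂` only through conjugation by a diagonal matrix, because
scaling and translation of `u` make the isomonodromy equation linear with constant diagonal
(`IsShrinkingSolution.reduction`).  The quantity `y` is invariant under such a conjugation, hence a
function of `z₃` alone, or of `log x`, since `x = 1 / (1 + z₃)`; `logZ` is the inverse of `logX`.
By the same argument the regularized limit of `t ↦ Φ ![0, 0, t]` is `Φ₀` itself.

The five invariants of `Φ` under diagonal conjugation are subject to three relations, given by the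
eigenvalues and by `p q = a b c`, and are rational functions of `v` and `R`
(`harnad_parametrization`).  In these variables the flow becomes a first-order system for `y` and
`V = λ₃ - Φ₁₁ + v` (`hasDerivAt_harnad`).  As `y'` is affine in `V`, elimination of `V` yields a second-order
equation for `y`, the sixth Painlevé equation (`isPainleveSixAt_of_velocity`).

For the behaviour at `x = 0`, write `Φ = z₃^{-ad δ₂Φ₀} (Φ₀ + o(1))` and decompose `δ₂Φ₀` spectrally.  The
products of an entry of the last column with an entry of the last row grow like `z₃^σ`, with leading
coefficients of rank one (`tendsto_exp_mul_col_mul_row`).  The one of `Φ₁₃ Φ₃₁` is a quarter of the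
right-hand side of the definition of `J` (`four_mul_leadingCoeff`), so `J ≠ 0` makes it nonzero.  It
follows that no denominator vanishes and that `R z₃^σ → 1 / J` (`tendsto_harnad`).  The delicate case is
`λ₂ = m₁`, where the denominator of `v` tends to zero; its exact order is then found by integrating its
derivative from infinity (`tendsto_exp_mul_of_hasDerivAt`).
-/

namespace Isomonodromy

/-! ### The Hamiltonian system behind Painlevé VI -/

/-- The derivative of `y` with respect to `log x` along the isomonodromy flow, as a function of `x`,
`y` and the variable `V = λ₃ - Φ₁₁ + v`, on which it depends affinely; `θ` stands for `θ_∞`. -/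
noncomputable def velocityY (θ₁ θ₃ θ x y V : ℂ) : ℂ :=
  y + (-y * (y - x) + (1 - y) * (y * (θ₁ + θ₃ - θ) - 2 * V * x)
    + (y - x) * (y * θ₃ - θ₁ * (1 - y))) / (1 - x)

/-- The derivative of `V = λ₃ - Φ₁₁ + v` with respect to `log x` along the isomonodromy flow.  The
constant `n` is `λ₂ - Φ₁₁ + λ₃ - Φ₃₃ = (θ₁ + θ₃ - θ₂ - θ_∞) / 2`. -/
noncomputable def velocityV (θ₁ θ₂ n x y V : ℂ) : ℂ :=
  (y - x) * V * (V - θ₁) / (y * (1 - x)) - y * (n - V) * (n + θ₂ - V) / (y - x)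

/-- Elimination of `V`: the left-hand side is `x⁻² (d F / d log x - F)`, that is `d²y/dx²`, with the
derivative of `F` written out by the product and quotient rules. -/
theorem painleveSix_of_velocity (x y V F V' θ₁ θ₂ θ₃ θ n : ℂ) (hx : x ≠ 0) (hx1 : x ≠ 1)
    (hy : y ≠ 0) (hy1 : y ≠ 1) (hyx : y ≠ x) (hn : 2 * n = θ₁ + θ₃ - θ₂ - θ)
    (hF : F = velocityY θ₁ θ₃ θ x y V) (hV : V' = velocityV θ₁ θ₂ n x y V) :
    1 / x ^ 2 * ((F + ((-F * (y - x) - y * (F - x) + (-F) * (y * (θ₁ + θ₃ - θ) - 2 * V * x)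
      + (1 - y) * (F * (θ₁ + θ₃ - θ) - 2 * (V' * x + V * x))
      + (F - x) * (y * θ₃ - θ₁ * (1 - y)) + (y - x) * (F * θ₃ + θ₁ * F)) * (1 - x)
      + x * (-y * (y - x) + (1 - y) * (y * (θ₁ + θ₃ - θ) - 2 * V * x)
        + (y - x) * (y * θ₃ - θ₁ * (1 - y)))) / (1 - x) ^ 2) - F) =
    1 / 2 * (1 / y + 1 / (y - 1) + 1 / (y - x)) * (1 / x * F) ^ 2
    - (1 / x + 1 / (x - 1) + 1 / (y - x)) * (1 / x * F)
    + y * (y - 1) * (y - x) / (x ^ 2 * (x - 1) ^ 2) *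
      ((θ - 1) ^ 2 / 2 + (-θ₁ ^ 2 / 2) * (x / y ^ 2) + θ₃ ^ 2 / 2 * ((x - 1) / (y - 1) ^ 2)
        + (1 - θ₂ ^ 2) / 2 * (x * (x - 1) / (y - x) ^ 2)) := by
  have h1 : x - 1 ≠ 0 := sub_ne_zero.2 hx1
  have h3 : y - 1 ≠ 0 := sub_ne_zero.2 hy1
  have h4 : y - x ≠ 0 := sub_ne_zero.2 hyx
  rw [velocityY] at hF
  rw [velocityV] at hV
  have e : 1 - x = -(x - 1) := by ring
  rw [e] at hF hV ⊢
  obtain rfl : θ = θ₁ + θ₃ - θ₂ - 2 * n := by linear_combination hn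
  rw [hF, hV]
  field_simp
  ring

/-- A solution of the first-order system for `(y, V)` solves the sixth Painlevé equation.  The equation
for `y` is differentiated once more, so it is needed in a neighbourhood of the point. -/
theorem isPainleveSixAt_of_velocity {Y V : ℂ → ℂ} {ξ θ₁ θ₂ θ₃ θ n : ℂ}
    (hn : 2 * n = θ₁ + θ₃ - θ₂ - θ) (hx1 : Complex.exp ξ ≠ 1) (hy : Y ξ ≠ 0) (hy1 : Y ξ ≠ 1)
    (hyx : Y ξ ≠ Complex.exp ξ)
    (hY : ∀ᶠ η in 𝓝 ξ, HasDerivAt Y (velocityY θ₁ θ₃ θ (Complex.exp η) (Y η) (V η)) η)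
    (hV : HasDerivAt V (velocityV θ₁ θ₂ n (Complex.exp ξ) (Y ξ) (V ξ)) ξ) :
    IsPainleveSixAt ((θ - 1) ^ 2 / 2) (-θ₁ ^ 2 / 2) (θ₃ ^ 2 / 2) ((1 - θ₂ ^ 2) / 2) Y ξ := by
  refine ⟨?_, hx1, hy, hy1, hyx, ?_⟩
  · rw [Complex.analyticAt_iff_eventually_differentiableAt]
    exact hY.mono fun η h => h.differentiableAt
  have hd : ∀ᶠ η in 𝓝 ξ, ddx Y η =
      Complex.exp (-η) * velocityY θ₁ θ₃ θ (Complex.exp η) (Y η) (V η) :=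
    hY.mono fun η h => by rw [ddx, h.deriv]
  have hY0 := hY.self_of_nhds
  have h1x : 1 - Complex.exp ξ ≠ 0 := sub_ne_zero.2 (Ne.symm hx1)
  have hx := Complex.exp_ne_zero ξ
  have hE := Complex.hasDerivAt_exp ξ
  have hnum := (((hY0.neg.mul (hY0.sub hE)).add
    ((hY0.const_sub 1).mul ((hY0.mul_const (θ₁ + θ₃ - θ)).sub ((hV.const_mul 2).mul hE)))).add
    ((hY0.sub hE).mul ((hY0.mul_const θ₃).sub ((hY0.const_sub 1).const_mul θ₁))))
  have hF := hY0.add (hnum.div (hE.const_sub 1) h1x)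
  have hE' : HasDerivAt (fun η : ℂ => Complex.exp (-η)) (-Complex.exp (-ξ)) ξ := by
    simpa using (hasDerivAt_neg ξ).cexp
  have hG := hE'.mul hF
  have hdd : HasDerivAt (ddx Y) _ ξ := hG.congr_of_eventuallyEq <| by
    filter_upwards [hd] with η h
    simp [h, velocityY]
  have key := painleveSix_of_velocity _ _ _ _ _ θ₁ θ₂ θ₃ θ n hx hx1 hy hy1 hyx hn rfl
    (rfl : velocityV θ₁ θ₂ n (Complex.exp ξ) (Y ξ) (V ξ) = _)
  have hdY : ddx Y ξ = 1 / Complex.exp ξ *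
      velocityY θ₁ θ₃ θ (Complex.exp ξ) (Y ξ) (V ξ) := by
    rw [hd.self_of_nhds, Complex.exp_neg, one_div]
  rw [hdY, ← key, ddx, hdd.deriv]
  simp only [Pi.add_apply, Pi.sub_apply, Pi.mul_apply, Pi.div_apply, Pi.neg_apply, Complex.exp_neg]
  have hFv := velocityY.eq_def θ₁ θ₃ θ (Complex.exp ξ) (Y ξ) (V ξ)
  generalize velocityY θ₁ θ₃ θ (Complex.exp ξ) (Y ξ) (V ξ) = F at *
  generalize velocityV θ₁ θ₂ n (Complex.exp ξ) (Y ξ) (V ξ) = G at *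
  field_simp at hFv ⊢
  linear_combination (1 - Complex.exp ξ) * hFv

/-! ### The invariants in terms of `v` and `R` -/

/-- Comparison of the coefficients of the characteristic polynomial with the elementary symmetric
functions of the eigenvalues. -/
theorem charpoly_relations {l : Fin 3 → ℂ} {A : Matrix (Fin 3) (Fin 3) ℂ}
    (h : A.charpoly = (Polynomial.X - Polynomial.C (l 0)) * (Polynomial.X - Polynomial.C (l 1)) *
      (Polynomial.X - Polynomial.C (l 2))) :
    l 0 + l 1 + l 2 = A 0 0 + A 1 1 + A 2 2 ∧
    l 0 * l 1 + l 0 * l 2 + l 1 * l 2 = A 0 0 * A 1 1 + A 0 0 * A 2 2 + A 1 1 * A 2 2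
      - A 0 1 * A 1 0 - A 0 2 * A 2 0 - A 1 2 * A 2 1 ∧
    l 0 * l 1 * l 2 = A 0 0 * A 1 1 * A 2 2 + A 0 1 * A 1 2 * A 2 0 + A 0 2 * A 2 1 * A 1 0
      - A 2 2 * (A 0 1 * A 1 0) - A 1 1 * (A 0 2 * A 2 0) - A 0 0 * (A 1 2 * A 2 1) := by
  have key (t : ℂ) : (t - l 0) * (t - l 1) * (t - l 2) =
      (t - A 0 0) * ((t - A 1 1) * (t - A 2 2) - A 1 2 * A 2 1)
      - A 0 1 * (A 1 0 * (t - A 2 2) + A 1 2 * A 2 0)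
      - A 0 2 * (A 1 0 * A 2 1 + (t - A 1 1) * A 2 0) := by
    have := congrArg (Polynomial.eval t) h
    rw [Matrix.eval_charpoly, Matrix.det_fin_three] at this
    simp at this
    linear_combination -this
  have h0 := key 0
  have h1 := key 1
  have h2 := key (-1)
  refine ⟨?_, ?_, ?_⟩
  · linear_combination (-(1 : ℂ) / 2) * h1 - (1 / 2 : ℂ) * h2 + h0
  · linear_combination (1 / 2 : ℂ) * h1 - (1 / 2 : ℂ) * h2
  · linear_combination -h0

/-- The invariants `a = Φ₁₂Φ₂₁`, `b = Φ₁₃Φ₃₁`, `c = Φ₂₃Φ₃₂`, `p = Φ₁₂Φ₂₃Φ₃₁`, `q = Φ₁₃Φ₃₂Φ₂₁` of a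
matrix with given diagonal and eigenvalues form a rational surface, parametrized by `v` and `R`.  If the
eigenvector for `λ₂` is normalized to `(1, 1, 1)` by a diagonal conjugation, then the matrix becomes
`!![f₁, n - R V, β; K, f₂, l₁ - f₂ - K; v, n - V, f₃]` with `β = R V - (l₂ - f₃)`, and the second row is
determined by the requirement that `l₂` be an eigenvalue. -/
theorem harnad_parametrization {l₀ l₁ l₂ f₁ f₂ f₃ a b c p q D v R n V K : ℂ}
    (htr : l₀ + l₁ + l₂ = f₁ + f₂ + f₃)
    (hmin : l₀ * l₁ + l₀ * l₂ + l₁ * l₂ = f₁ * f₂ + f₁ * f₃ + f₂ * f₃ - a - b - c)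
    (hdet : l₀ * l₁ * l₂ = f₁ * f₂ * f₃ + p + q - f₃ * a - f₂ * b - f₁ * c)
    (hpq : p * q = a * b * c)
    (hDdef : D = (l₁ - f₁) * (l₁ - f₂) - a) (hD : D ≠ 0)
    (hvdef : v * D = p + (l₁ - f₂) * b) (hv : v ≠ 0)
    (hVdef : V = v + (l₂ - f₁)) (hV : V ≠ 0) (hR : R * v * V = (l₂ - f₃) * v + b) (hR1 : R ≠ 1)
    (hn : n = l₁ - f₁ + (l₂ - f₃)) (hK : K = v + (n + (l₂ - f₂) - V) / (1 - R)) :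
    b = (R * V - (l₂ - f₃)) * v ∧ a = (n - R * V) * K ∧ c = (l₁ - f₂ - K) * (n - V) ∧
    p = (n - R * V) * (l₁ - f₂ - K) * v ∧ q = (R * V - (l₂ - f₃)) * (n - V) * K := by
  have hR1' : 1 - R ≠ 0 := sub_ne_zero.2 hR1.symm
  have hb : b = (R * V - (l₂ - f₃)) * v := by linear_combination -hR
  obtain ⟨β, hβ⟩ : ∃ β, β = R * V - (l₂ - f₃) := ⟨_, rfl⟩
  rw [← hβ] at hb ⊢
  have e1 : l₁ ^ 2 * (f₁ + f₂ + f₃) = l₁ ^ 2 * (l₀ + l₁ + l₂) := by rw [htr]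
  -- the value of the characteristic polynomial at its root `l₁`
  have hroot : (l₁ - f₁) * (l₁ - f₂) * (l₁ - f₃) - a * (l₁ - f₃) - b * (l₁ - f₂)
      - c * (l₁ - f₁) - p - q = 0 := by
    linear_combination -e1 - l₁ * hmin + hdet
  obtain ⟨P, hP⟩ : ∃ P, P = D - (l₁ - f₂) * β := ⟨_, rfl⟩
  have hp : p = v * P := by linear_combination -hvdef - (l₁ - f₂) * hb - v * hP
  have hq : q + (l₁ - f₂) * b = β * ((l₁ - f₂) * (l₁ - f₃) - c) := by
    have : v * D * (q + (l₁ - f₂) * b - β * ((l₁ - f₂) * (l₁ - f₃) - c)) = 0 := by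
      linear_combination (q + (l₁ - f₂) * b) * hvdef + D * ((l₁ - f₂) * (l₁ - f₃) - c) * hb
        - b * ((l₁ - f₂) * (l₁ - f₃) - c) * hDdef + hpq - b * (l₁ - f₂) * hroot
    have := (mul_eq_zero.1 this).resolve_left (mul_ne_zero hv hD)
    linear_combination this
  have hLc : (l₁ - f₃ - v) * P = (l₁ - f₁ - β) * c := by
    linear_combination hroot + (l₁ - f₃) * hDdef - hvdef + hq + (l₁ - f₃ - v) * hP - (l₁ - f₂) * hb
  have hVR : n - V - (n - R * V) = -((1 - R) * V) := by ring
  have hL : l₁ - f₁ - β = n - R * V := by linear_combination -hβ - hn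
  have hw : l₁ - f₃ - v = n - V := by linear_combination hVdef - hn
  rw [hL, hw] at hLc
  have hne : (1 - R) * V ≠ 0 := mul_ne_zero hR1' hV
  obtain ⟨κ, hκ⟩ : ∃ κ, κ = (P - c) / ((1 - R) * V) := ⟨_, rfl⟩
  have hκ' : κ * ((1 - R) * V) = P - c := by rw [hκ]; field_simp
  have hPκ : P = (n - R * V) * κ := by
    apply mul_right_cancel₀ hne
    linear_combination (-(n - R * V)) * hκ' - hLc
  have hcκ : c = κ * (n - V) := by
    apply mul_right_cancel₀ hne
    linear_combination (-(n - V)) * hκ' - hLc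
  have haκ : a = (n - R * V) * (l₁ - f₂ - κ) := by
    linear_combination hDdef + hP - hPκ + (l₁ - f₂) * hL
  have hKκ : K = l₁ - f₂ - κ := by
    apply mul_right_cancel₀ hne
    have : K * ((1 - R) * V) = (v * (1 - R) + (n + (l₂ - f₂) - V)) * V := by
      rw [hK]; field_simp
    rw [this]
    obtain rfl : l₀ = f₁ + f₂ + f₃ - l₁ - l₂ := by linear_combination htr
    subst hn hVdef hβ
    linear_combination -hmin + haκ + hb + hcκ
  have hκK : l₁ - f₂ - K = κ := by rw [hKκ]; ring
  refine ⟨hb, by rw [hKκ]; exact haκ, by rw [hκK]; exact hcκ, ?_, ?_⟩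
  · rw [hκK, hp, hPκ]; ring
  · linear_combination hq - (l₁ - f₂) * hb - β * hcκ - β * (n - V) * hKκ
      + β * (l₁ - f₂) * hw

/-- The equation for `v`.  By the quotient rule for `v = (p + (l₁ - f₂) b) / D`, the left-hand side,
composed of the derivatives of `p`, `b` and `-D`, is `D` times the derivative of `v`. -/
theorem velocityV_identity {l₁ l₂ f₁ f₂ f₃ a b c p q D v R n V K x y : ℂ}
    (hDdef : D = (l₁ - f₁) * (l₁ - f₂) - a)
    (hVdef : V = v + (l₂ - f₁)) (hR1 : R ≠ 1)
    (hn : n = l₁ - f₁ + (l₂ - f₃)) (hK : K = v + (n + (l₂ - f₂) - V) / (1 - R))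
    (hb : b = (R * V - (l₂ - f₃)) * v) (ha : a = (n - R * V) * K)
    (hc : c = (l₁ - f₂ - K) * (n - V)) (hp : p = (n - R * V) * (l₁ - f₂ - K) * v)
    (hq : q = (R * V - (l₂ - f₃)) * (n - V) * K)
    (hx0 : x ≠ 0) (hx1 : x ≠ 1) (hE : x + (1 - x) * R ≠ 0) (hy : y = x / (x + (1 - x) * R)) :
    (x * b * c - a * c) / (1 - x) + a * b + p * ((f₂ - f₃) / (1 - x) + f₃ - f₁)
      + (l₁ - f₂) * ((p - q) / (1 - x)) + v * (x / (1 - x) * (q - p)) =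
    D * velocityV (l₂ - f₁) (l₂ - f₂) n x y V := by
  have h1 : 1 - x ≠ 0 := sub_ne_zero.2 hx1.symm
  have h2 : 1 - R ≠ 0 := sub_ne_zero.2 hR1.symm
  have h3 : y - x = y * (1 - x) * (1 - R) := by rw [hy]; field_simp; ring
  have hy0 : y ≠ 0 := by rw [hy]; exact div_ne_zero hx0 hE
  have hvel : velocityV (l₂ - f₁) (l₂ - f₂) n x y V =
      (1 - R) * V * v - (n - V) * (n + (l₂ - f₂) - V) / ((1 - R) * (1 - x)) := by
    rw [velocityV, h3, hVdef]; field_simp; ring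
  rw [hvel]
  obtain rfl : v = V - (l₂ - f₁) := by rw [hVdef]; ring
  obtain rfl : l₁ = n + f₁ - (l₂ - f₃) := by rw [hn]; ring
  subst hDdef hb ha hc hp hq hK
  field_simp
  ring

/-- The equation for `y`.  The left-hand side is the derivative of `x / (x + (1 - x) R)`, where the
derivative `R'` of `R` comes from `R v V = (l₂ - f₃) v + b`. -/
theorem velocityY_identity {l₁ l₂ f₁ f₂ f₃ b p q v v' b' R R' n V K x y θ : ℂ}
    (hVdef : V = v + (l₂ - f₁)) (hV : V ≠ 0) (hv : v ≠ 0) (hR1 : R ≠ 1)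
    (hn : n = l₁ - f₁ + (l₂ - f₃)) (hK : K = v + (n + (l₂ - f₂) - V) / (1 - R))
    (hθ : 2 * n = (l₂ - f₁) + (l₂ - f₃) - (l₂ - f₂) - θ)
    (hb : b = (R * V - (l₂ - f₃)) * v) (hp : p = (n - R * V) * (l₁ - f₂ - K) * v)
    (hq : q = (R * V - (l₂ - f₃)) * (n - V) * K)
    (hb' : b' = (p - q) / (1 - x)) (hv' : v' = velocityV (l₂ - f₁) (l₂ - f₂) n x y V)
    (hR' : R' * (v * V) = (l₂ - f₃) * v' + b' - R * (v' * V + v * v'))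
    (hx0 : x ≠ 0) (hx1 : x ≠ 1) (hE : x + (1 - x) * R ≠ 0) (hy : y = x / (x + (1 - x) * R)) :
    (x * (x + (1 - x) * R) - x * (x + (-x * R + (1 - x) * R'))) / (x + (1 - x) * R) ^ 2 =
    velocityY (l₂ - f₁) (l₂ - f₃) θ x y V := by
  have h1 : 1 - x ≠ 0 := sub_ne_zero.2 hx1.symm
  have h2 : 1 - R ≠ 0 := sub_ne_zero.2 hR1.symm
  have h3 : y - x = y * (1 - x) * (1 - R) := by rw [hy]; field_simp; ring
  have hy0 : y ≠ 0 := by rw [hy]; exact div_ne_zero hx0 hE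
  have hvel : velocityV (l₂ - f₁) (l₂ - f₂) n x y V =
      (1 - R) * V * v - (n - V) * (n + (l₂ - f₂) - V) / ((1 - R) * (1 - x)) := by
    rw [velocityV, h3, hVdef]; field_simp; ring
  have hRR : R' * (1 - x) = -(R * (2 * n + (l₂ - f₂)) - 2 * R * V * (x + (1 - x) * R)
      + (1 - R) * (x * (l₂ - f₃) - (1 - x) * (l₂ - f₁) * R)) := by
    apply mul_right_cancel₀ (mul_ne_zero hv hV)
    rw [mul_right_comm, hR', hv', hvel, hb', hp, hq, hK]
    obtain rfl : l₁ = n + f₁ - (l₂ - f₃) := by rw [hn]; ring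
    obtain rfl : v = V - (l₂ - f₁) := by rw [hVdef]; ring
    field_simp
    ring
  obtain rfl : θ = (l₂ - f₁) + (l₂ - f₃) - (l₂ - f₂) - 2 * n := by linear_combination hθ
  rw [mul_comm (1 - x) R', hRR, hy, velocityY]
  field_simp
  ring

/-- The matrix `(u₃ - u₂) ad_u⁻¹ ad_{E₃} A`, which governs the equation in the direction of
`log z₃`.  It depends on `u` only through `x`, because `(u₃ - u₂) / (u₃ - u₁) = 1 - x`. -/
def flowMatrix (x : ℂ) (A : Matrix (Fin 3) (Fin 3) ℂ) : Matrix (Fin 3) (Fin 3) ℂ :=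
  !![0, 0, (1 - x) * A 0 2; 0, 0, A 1 2; (1 - x) * A 2 0, A 2 1, 0]

theorem comm_flowMatrix (x : ℂ) (A : Matrix (Fin 3) (Fin 3) ℂ) :
    comm (flowMatrix x A) A =
      !![0, -x * A 0 2 * A 2 1, (1 - x) * (A 2 2 - A 0 0) * A 0 2 - A 0 1 * A 1 2;
        x * A 1 2 * A 2 0, 0, (A 2 2 - A 1 1) * A 1 2 - (1 - x) * A 1 0 * A 0 2;
        (1 - x) * (A 0 0 - A 2 2) * A 2 0 + A 2 1 * A 1 0,
        (1 - x) * A 2 0 * A 0 1 + (A 1 1 - A 2 2) * A 2 1, 0] := by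
  ext i j
  simp only [comm, Matrix.sub_apply, Matrix.mul_apply, Fin.sum_univ_three]
  fin_cases i <;> fin_cases j <;> simp [flowMatrix] <;> ring

/-- The isomonodromy flow, written in terms of `log x`, implies the first-order system for `(y, V)`. -/
theorem hasDerivAt_harnad {l : Fin 3 → ℂ} {A : ℂ → Matrix (Fin 3) (Fin 3) ℂ} {ξ θ n : ℂ}
    (hA : ∀ i j, HasDerivAt (fun η => A η i j)
      (-(1 / (1 - Complex.exp ξ)) * comm (flowMatrix (Complex.exp ξ) (A ξ)) (A ξ) i j) ξ)
    (hchar : (A ξ).charpoly = (Polynomial.X - Polynomial.C (l 0)) *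
      (Polynomial.X - Polynomial.C (l 1)) * (Polynomial.X - Polynomial.C (l 2)))
    (hx1 : Complex.exp ξ ≠ 1) (hdef : HarnadDefined l (A ξ) (Complex.exp ξ))
    (hy : harnadY l (A ξ) (Complex.exp ξ) ≠ Complex.exp ξ)
    (hn : n = l 1 - A ξ 0 0 + (l 2 - A ξ 2 2)) (hθ : θ = l 0 - l 1) :
    HasDerivAt (fun η => l 2 - A η 0 0 + harnadV l (A η))
      (velocityV (l 2 - A ξ 0 0) (l 2 - A ξ 1 1) n (Complex.exp ξ)
        (harnadY l (A ξ) (Complex.exp ξ)) (l 2 - A ξ 0 0 + harnadV l (A ξ))) ξ ∧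
    HasDerivAt (fun η => harnadY l (A η) (Complex.exp η))
      (velocityY (l 2 - A ξ 0 0) (l 2 - A ξ 2 2) θ (Complex.exp ξ)
        (harnadY l (A ξ) (Complex.exp ξ)) (l 2 - A ξ 0 0 + harnadV l (A ξ))) ξ := by
  obtain ⟨hD, hv, hV, hE⟩ := hdef
  obtain ⟨htr, hmin, hdet⟩ := charpoly_relations hchar
  have hx0 := Complex.exp_ne_zero ξ
  have h1x : 1 - Complex.exp ξ ≠ 0 := sub_ne_zero.2 hx1.symm
  have hR1 : harnadR l (A ξ) ≠ 1 := by
    intro h; apply hy; rw [harnadY, h]; simp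
  have hvdef : harnadV l (A ξ) * harnadD l (A ξ) = A ξ 0 1 * A ξ 1 2 * A ξ 2 0 +
      (l 1 - A ξ 1 1) * (A ξ 0 2 * A ξ 2 0) := by
    rw [harnadV, div_mul_cancel₀ _ hD, mul_assoc (l 1 - _)]
  have hRdef : harnadR l (A ξ) * harnadV l (A ξ) * (l 2 - A ξ 0 0 + harnadV l (A ξ)) =
      (l 2 - A ξ 2 2) * harnadV l (A ξ) + A ξ 0 2 * A ξ 2 0 := by
    rw [harnadR]; field_simp; ring
  obtain ⟨hb, ha, hc, hp, hq⟩ := harnad_parametrization (D := harnadD l (A ξ)) htr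
    (by linear_combination hmin) hdet
    (by ring) rfl hD hvdef hv (add_comm _ _) hV hRdef hR1 hn rfl
  have hEE := Complex.hasDerivAt_exp ξ
  generalize hx : Complex.exp ξ = x at *
  rw [comm_flowMatrix] at hA
  have d00 : HasDerivAt (fun η => A η 0 0) 0 ξ := (hA 0 0).congr_deriv (by simp)
  have d11 : HasDerivAt (fun η => A η 1 1) 0 ξ := (hA 1 1).congr_deriv (by simp)
  have d22 : HasDerivAt (fun η => A η 2 2) 0 ξ := (hA 2 2).congr_deriv (by simp)
  have da : HasDerivAt (fun η => A η 0 1 * A η 1 0)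
      (x / (1 - x) * (A ξ 0 2 * A ξ 2 1 * A ξ 1 0 - A ξ 0 1 * A ξ 1 2 * A ξ 2 0)) ξ :=
    ((hA 0 1).mul (hA 1 0)).congr_deriv (by simp; field_simp; ring)
  have db : HasDerivAt (fun η => A η 0 2 * A η 2 0)
      ((A ξ 0 1 * A ξ 1 2 * A ξ 2 0 - A ξ 0 2 * A ξ 2 1 * A ξ 1 0) / (1 - x)) ξ :=
    ((hA 0 2).mul (hA 2 0)).congr_deriv (by simp; field_simp; ring)
  have dp : HasDerivAt (fun η => A η 0 1 * A η 1 2 * A η 2 0)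
      ((x * (A ξ 0 2 * A ξ 2 0) * (A ξ 1 2 * A ξ 2 1)
        - A ξ 0 1 * A ξ 1 0 * (A ξ 1 2 * A ξ 2 1)) / (1 - x)
        + A ξ 0 1 * A ξ 1 0 * (A ξ 0 2 * A ξ 2 0)
        + A ξ 0 1 * A ξ 1 2 * A ξ 2 0 * ((A ξ 1 1 - A ξ 2 2) / (1 - x) + A ξ 2 2 - A ξ 0 0)) ξ :=
    (((hA 0 1).mul (hA 1 2)).mul (hA 2 0)).congr_deriv (by simp; field_simp; ring)
  have dD : HasDerivAt (fun η => harnadD l (A η)) (-(x / (1 - x) *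
      (A ξ 0 2 * A ξ 2 1 * A ξ 1 0 - A ξ 0 1 * A ξ 1 2 * A ξ 2 0))) ξ :=
    (((d00.const_sub (l 1)).mul (d11.const_sub (l 1))).sub da).congr_deriv (by ring)
  have dv : HasDerivAt (fun η => harnadV l (A η))
      (velocityV (l 2 - A ξ 0 0) (l 2 - A ξ 1 1) n x
        (harnadY l (A ξ) x) (l 2 - A ξ 0 0 + harnadV l (A ξ))) ξ := by
    have hN : HasDerivAt (fun η => A η 0 1 * A η 1 2 * A η 2 0
        + (l 1 - A η 1 1) * A η 0 2 * A η 2 0) _ ξ :=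
      (dp.add ((d11.const_sub (l 1)).mul db)).congr_of_eventuallyEq
        (.of_forall fun η => by simp [mul_assoc])
    have key := velocityV_identity (y := harnadY l (A ξ) x) rfl (add_comm _ _) hR1 hn rfl
      hb ha hc hp hq hx0 hx1 hE rfl
    refine (hN.div dD hD).congr_deriv ?_
    rw [div_eq_iff (pow_ne_zero 2 hD), harnadD]
    rw [harnadD] at hvdef
    linear_combination ((l 1 - A ξ 0 0) * (l 1 - A ξ 1 1) - A ξ 0 1 * A ξ 1 0) * key
      - (x / (1 - x) * (A ξ 0 2 * A ξ 2 1 * A ξ 1 0 - A ξ 0 1 * A ξ 1 2 * A ξ 2 0)) * hvdef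
  have dV : HasDerivAt (fun η => l 2 - A η 0 0 + harnadV l (A η)) _ ξ :=
    (d00.const_sub (l 2)).add dv
  rw [neg_zero, zero_add] at dV
  refine ⟨dV, ?_⟩
  have hvV := mul_ne_zero hv hV
  have dR := (((d22.const_sub (l 2)).mul dv).add db).div (dv.mul dV) hvV
  have hReq : (fun η => harnadR l (A η)) =ᶠ[𝓝 ξ] fun η =>
      ((l 2 - A η 2 2) * harnadV l (A η) + A η 0 2 * A η 2 0) /
        (harnadV l (A η) * (l 2 - A η 0 0 + harnadV l (A η))) := by
    filter_upwards [dv.continuousAt.eventually_ne hv, dV.continuousAt.eventually_ne hV]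
      with η h1 h2
    rw [harnadR]; field_simp; ring
  obtain ⟨R', dR', hR'⟩ : ∃ R', HasDerivAt (fun η => harnadR l (A η)) R' ξ ∧
      R' * (harnadV l (A ξ) * (l 2 - A ξ 0 0 + harnadV l (A ξ))) =
        (l 2 - A ξ 2 2) * velocityV (l 2 - A ξ 0 0) (l 2 - A ξ 1 1) n x
          (harnadY l (A ξ) x) (l 2 - A ξ 0 0 + harnadV l (A ξ))
        + (A ξ 0 1 * A ξ 1 2 * A ξ 2 0 - A ξ 0 2 * A ξ 2 1 * A ξ 1 0) / (1 - x)
        - harnadR l (A ξ) * (velocityV (l 2 - A ξ 0 0) (l 2 - A ξ 1 1) n x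
          (harnadY l (A ξ) x) (l 2 - A ξ 0 0 + harnadV l (A ξ)) *
            (l 2 - A ξ 0 0 + harnadV l (A ξ)) + harnadV l (A ξ) *
          velocityV (l 2 - A ξ 0 0) (l 2 - A ξ 1 1) n x
          (harnadY l (A ξ) x) (l 2 - A ξ 0 0 + harnadV l (A ξ))) := by
    refine ⟨_, dR.congr_of_eventuallyEq hReq, ?_⟩
    simp only [Pi.add_apply, Pi.mul_apply]
    rw [← hRdef]
    generalize velocityV _ _ _ _ _ _ = G
    field_simp
    ring
  have dY := hEE.div (hEE.add ((hEE.const_sub 1).mul dR')) (by simpa [hx] using hE)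
  refine HasDerivAt.congr_deriv (f := fun η => harnadY l (A η) (Complex.exp η)) dY ?_
  simp only [Pi.add_apply, Pi.mul_apply, hx]
  exact velocityY_identity (add_comm _ _) hV hv hR1 hn rfl
    (by rw [hθ, hn]; linear_combination htr) hb hp hq rfl rfl hR' hx0 hx1 hE rfl

/-! ### Reduction to one variable -/

theorem uOfLog_zero (ζ : Fin 3 → ℂ) : uOfLog ζ 0 = Complex.exp (ζ 0) := by
  have e : Finset.Iic (0 : Fin 3) = {0} := by decide
  simp [uOfLog, e]

theorem uOfLog_one (ζ : Fin 3 → ℂ) :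
    uOfLog ζ 1 = Complex.exp (ζ 0) + Complex.exp (ζ 0) * Complex.exp (ζ 1) := by
  have e : Finset.Iic (0 : Fin 3) = {0} := by decide
  have e' : Finset.Iic (1 : Fin 3) = {0, 1} := by decide
  simp [uOfLog, e, e']

theorem uOfLog_two (ζ : Fin 3 → ℂ) :
    uOfLog ζ 2 = Complex.exp (ζ 0) + Complex.exp (ζ 0) * Complex.exp (ζ 1)
      + Complex.exp (ζ 0) * Complex.exp (ζ 1) * Complex.exp (ζ 2) := by
  have e : Finset.Iic (0 : Fin 3) = {0} := by decide
  have e' : Finset.Iic (1 : Fin 3) = {0, 1} := by decide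
  have e'' : Finset.Iic (2 : Fin 3) = {0, 1, 2} := by decide
  have n1 : (0 : Fin 3) ∉ ({1, 2} : Finset (Fin 3)) := by decide
  have n2 : (1 : Fin 3) ∉ ({2} : Finset (Fin 3)) := by decide
  simp only [uOfLog, e'', Finset.sum_insert n1, Finset.sum_insert n2, Finset.sum_singleton, e,
    e', Finset.prod_insert n1, Finset.prod_insert n2, Finset.prod_singleton]
  rw [Finset.prod_pair (by decide)]
  ring

/-- The matrix `ad_u⁻¹ ad_{diag c} A`, which governs the isomonodromy equation in the direction `c`
of the space of all `u`. -/
noncomputable def adInvDiag {n : ℕ} (u c : Fin n → ℂ) (A : Matrix (Fin n) (Fin n) ℂ) :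
    Matrix (Fin n) (Fin n) ℂ :=
  Matrix.of fun i j => if i = j then 0 else (c i - c j) * A i j / (u i - u j)

theorem sum_mul_isoRHS {n : ℕ} (u c : Fin n → ℂ) (A : Matrix (Fin n) (Fin n) ℂ) (i j : Fin n) :
    ∑ k, c k * isoRHS u A k i j = comm (adInvDiag u c A) A i j := by
  have h : ∑ k, c k • adInv u (comm (Matrix.single k k 1) A) = adInvDiag u c A := by
    ext a b
    simp only [Matrix.sum_apply, Matrix.smul_apply, adInv, adInvDiag, comm, Matrix.of_apply,
      Matrix.sub_apply, smul_eq_mul]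
    split_ifs with hab
    · simp
    · simp [Matrix.mul_apply, Matrix.single_apply, sub_mul, sub_div, mul_sub, ite_and,
        Finset.sum_sub_distrib, mul_div_assoc, ite_div, mul_ite]
  rw [comm, ← h, Finset.sum_mul, Finset.mul_sum, Matrix.sub_apply, Matrix.sum_apply,
    Matrix.sum_apply, ← Finset.sum_sub_distrib]
  refine Finset.sum_congr rfl fun k _ => ?_
  rw [isoRHS, comm, smul_mul_assoc, mul_smul_comm]
  simp [mul_sub]

/-- The derivative of an isomonodromy solution along a holomorphic curve. -/
theorem IsIsomonodromySolutionOn.hasDerivAt {n : ℕ} {W : Set (Fin n → ℂ)}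
    {Φ : (Fin n → ℂ) → Matrix (Fin n) (Fin n) ℂ} (h : IsIsomonodromySolutionOn W Φ)
    {γ : ℂ → Fin n → ℂ} {γ' c : Fin n → ℂ} {t : ℂ} (hγ : HasDerivAt γ γ' t) (ht : γ t ∈ W)
    (hc : ∀ k, HasDerivAt (fun s => uOfLog (γ s) k) (c k) t) (i j : Fin n) :
    HasDerivAt (fun s => Φ (γ s) i j)
      (comm (adInvDiag (uOfLog (γ t)) c (Φ (γ t))) (Φ (γ t)) i j) t := by
  have h1 := ((h _ ht).2 i j).comp_hasDerivAt t hγ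
  refine h1.congr_deriv ?_
  rw [← sum_mul_isoRHS, sum_apply]
  refine Finset.sum_congr rfl fun k _ => ?_
  have hd : DifferentiableAt ℂ (fun η : Fin n → ℂ => uOfLog η k) (γ t) := by
    unfold uOfLog; fun_prop
  have h2 := (hd.hasFDerivAt.comp_hasDerivAt t hγ).unique (hc k)
  rw [smul_apply, h2, smul_eq_mul, mul_comm]

/-- In the directions of a common scaling or translation of `u`, where `c i - c j = u i - u j`, the
equation is linear once the diagonal is known. -/
theorem comm_adInvDiag_of_scaling {n : ℕ} {u c : Fin n → ℂ} (A : Matrix (Fin n) (Fin n) ℂ)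
    (hu : Function.Injective u) (hc : ∀ i j, c i - c j = u i - u j) (i j : Fin n) :
    comm (adInvDiag u c A) A i j = -(A i i - A j j) * A i j := by
  have h : adInvDiag u c A = A - Matrix.diagonal (fun i => A i i) := by
    ext a b
    simp only [adInvDiag, Matrix.of_apply, Matrix.sub_apply]
    by_cases hab : a = b
    · simp [hab]
    · rw [if_neg hab, Matrix.diagonal_apply_ne _ hab, hc, sub_zero,
        mul_div_cancel_left₀ _ (sub_ne_zero.2 (hu.ne hab))]
  rw [comm, h, sub_mul, mul_sub, Matrix.sub_apply, Matrix.sub_apply, Matrix.sub_apply,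
    Matrix.diagonal_mul, Matrix.mul_diagonal]
  ring


section OneVariable
variable {ρ : ℝ → ℝ} {Φ : (Fin 3 → ℂ) → Matrix (Fin 3) (Fin 3) ℂ}

theorem IsIsomonodromySolutionOn.hasDerivAt_zero (h : IsIsomonodromySolutionOn (logDomain ρ) Φ)
    (a b : ℂ) {t : ℂ} (ht : ρ t.im < t.re) (i j : Fin 3) :
    HasDerivAt (fun s => Φ ![s, b, t] i j)
      (-(Φ ![a, b, t] i i - Φ ![a, b, t] j j) * Φ ![a, b, t] i j) a := by
  have hmem : ![a, b, t] ∈ logDomain ρ := ht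
  have hγ : HasDerivAt (fun s : ℂ => ![s, b, t]) ![1, 0, 0] a := by
    rw [hasDerivAt_pi]
    intro k
    fin_cases k
    · exact hasDerivAt_id a
    · exact hasDerivAt_const a b
    · exact hasDerivAt_const a t
  have hE := Complex.hasDerivAt_exp a
  refine (h.hasDerivAt (c := uOfLog ![a, b, t]) hγ hmem ?_ i j).congr_deriv
    (comm_adInvDiag_of_scaling _ (h _ hmem).1 (fun _ _ => rfl) i j)
  intro k
  fin_cases k
  · simpa [uOfLog_zero] using hE
  · simpa [uOfLog_one] using hE.fun_add (hE.mul_const (Complex.exp b))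
  · simpa [uOfLog_two] using (hE.fun_add (hE.mul_const (Complex.exp b))).fun_add
      ((hE.mul_const (Complex.exp b)).mul_const (Complex.exp t))

theorem IsIsomonodromySolutionOn.hasDerivAt_one (h : IsIsomonodromySolutionOn (logDomain ρ) Φ)
    (a b : ℂ) {t : ℂ} (ht : ρ t.im < t.re) (i j : Fin 3) :
    HasDerivAt (fun s => Φ ![a, s, t] i j)
      (-(Φ ![a, b, t] i i - Φ ![a, b, t] j j) * Φ ![a, b, t] i j) b := by
  have hmem : ![a, b, t] ∈ logDomain ρ := ht
  have hγ : HasDerivAt (fun s : ℂ => ![a, s, t]) ![0, 1, 0] b := by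
    rw [hasDerivAt_pi]
    intro k
    fin_cases k
    · exact hasDerivAt_const b a
    · exact hasDerivAt_id b
    · exact hasDerivAt_const b t
  have hE := Complex.hasDerivAt_exp b
  refine (h.hasDerivAt (c := fun k => uOfLog ![a, b, t] k - uOfLog ![a, b, t] 0) hγ hmem ?_ i
    j).congr_deriv (comm_adInvDiag_of_scaling _ (h _ hmem).1 (fun _ _ => by ring) i j)
  intro k
  fin_cases k
  · simpa [uOfLog_zero] using hasDerivAt_const b (Complex.exp a)
  · simpa [uOfLog_zero, uOfLog_one] using (hE.const_mul (Complex.exp a)).const_add (Complex.exp a)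
  · refine (((hE.const_mul (Complex.exp a)).const_add (Complex.exp a)).add
      ((hE.const_mul (Complex.exp a)).mul_const (Complex.exp t))).congr_deriv ?_ |>.congr_of_eventuallyEq
        (.of_forall fun s => ?_)
    · simp [uOfLog_zero, uOfLog_two]; ring
    · simp [uOfLog_two]

theorem IsIsomonodromySolutionOn.hasDerivAt_two (h : IsIsomonodromySolutionOn (logDomain ρ) Φ)
    {t x : ℂ} (ht : ρ t.im < t.re) (hx : x * (1 + Complex.exp t) = 1) (i j : Fin 3) :
    HasDerivAt (fun s => Φ ![0, 0, s] i j)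
      (comm (flowMatrix x (Φ ![0, 0, t])) (Φ ![0, 0, t]) i j) t := by
  have hmem : ![0, 0, t] ∈ logDomain ρ := ht
  have hγ : HasDerivAt (fun s : ℂ => ![0, 0, s]) ![0, 0, 1] t := by
    rw [hasDerivAt_pi]
    intro k
    fin_cases k
    · exact hasDerivAt_const t 0
    · exact hasDerivAt_const t 0
    · exact hasDerivAt_id t
  have hE := Complex.hasDerivAt_exp t
  have hne := Complex.exp_ne_zero t
  have h1 : 1 + Complex.exp t ≠ 0 := right_ne_zero_of_mul_eq_one hx
  have hc : ∀ k, HasDerivAt (fun s => uOfLog ![0, 0, s] k) (![0, 0, Complex.exp t] k) t := by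
    intro k
    fin_cases k
    · simpa [uOfLog_zero] using hasDerivAt_const t (1 : ℂ)
    · simpa [uOfLog_one] using hasDerivAt_const t (1 + 1 : ℂ)
    · simpa [uOfLog_two] using hE.const_add (1 + 1 : ℂ)
  refine (h.hasDerivAt hγ hmem hc i j).congr_deriv ?_
  congr 2
  have hx' : 1 - x = Complex.exp t / (1 + Complex.exp t) := by
    rw [eq_div_iff h1]; linear_combination -hx
  ext a b
  fin_cases a <;> fin_cases b <;>
    simp [adInvDiag, flowMatrix, uOfLog_zero, uOfLog_one, uOfLog_two, hx']
  · rw [show 1 - (1 + 1 + Complex.exp t) = -(1 + Complex.exp t) by ring, neg_div_neg_eq]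
    field_simp
  · rw [show 1 + 1 + Complex.exp t - 1 = 1 + Complex.exp t by ring]
    field_simp

end OneVariable

theorem tendsto_add_ofReal_logAtInfty (z : ℂ) {M : ℝ} (hM : |z.im| ≤ M) :
    Tendsto (fun s : ℝ => z + s) atTop (logAtInfty M) := by
  refine tendsto_inf.2 ⟨tendsto_comap_iff.2 ?_, tendsto_principal.2 (.of_forall fun s => by simpa)⟩
  simpa [Function.comp_def] using tendsto_atTop_add_const_left atTop z.re tendsto_id

theorem logAtInfty_neBot {M : ℝ} (hM : 0 ≤ M) : (logAtInfty M).NeBot :=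
  (tendsto_add_ofReal_logAtInfty 0 (by simpa)).neBot

theorem eq_of_hasDerivAt_zero_of_tendsto {f : ℂ → ℂ} {z c : ℂ} {M : ℝ} (hM : |z.im| ≤ M)
    (hf : ∀ s : ℝ, 0 ≤ s → HasDerivAt f 0 (z + s)) (hc : Tendsto f (logAtInfty M) (𝓝 c)) :
    f z = c := by
  have hd (s : ℝ) (hs : 0 ≤ s) : HasDerivAt (fun s : ℝ => f (z + s)) 0 s := by
    have h1 : HasDerivAt (fun s : ℝ => z + (s : ℂ)) 1 s :=
      (HasDerivAt.ofReal_comp (hasDerivAt_id s)).const_add z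
    have h2 := (hf s hs).comp s h1
    rw [zero_mul] at h2
    exact h2
  have hconst (s : ℝ) (hs : 0 ≤ s) : f (z + s) = f z := by
    have := constant_of_has_deriv_right_zero (f := fun s : ℝ => f (z + s)) (a := 0) (b := s)
      (fun x hx => (hd x hx.1).continuousAt.continuousWithinAt)
      (fun x hx => (hd x hx.1).hasDerivWithinAt) s ⟨hs, le_rfl⟩
    simpa using this
  refine tendsto_nhds_unique ?_ (hc.comp (tendsto_add_ofReal_logAtInfty z hM))
  refine tendsto_const_nhds.congr' ?_
  filter_upwards [eventually_ge_atTop 0] with s hs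
  exact (hconst s hs).symm

theorem expAd_diagonal_apply {n : ℕ} (t : ℂ) (d : Fin n → ℂ) (Y : Matrix (Fin n) (Fin n) ℂ)
    (i j : Fin n) :
    expAd t (Matrix.diagonal d) Y i j = Complex.exp (t * (d i - d j)) * Y i j := by
  rw [expAd, ← Matrix.diagonal_smul, Matrix.diagonal_neg, Matrix.exp_diagonal,
    Matrix.exp_diagonal, Matrix.mul_diagonal, Matrix.diagonal_mul, mul_sub, sub_eq_add_neg,
    Complex.exp_add, Complex.exp_eq_exp_ℂ]
  simp [Pi.coe_exp]
  ring

theorem expAd_expAd_diagonal {n : ℕ} (s t : ℂ) (d : Fin n → ℂ) (Y : Matrix (Fin n) (Fin n) ℂ) :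
    expAd s (Matrix.diagonal d) (expAd t (Matrix.diagonal d) Y)
      = expAd (s + t) (Matrix.diagonal d) Y := by
  ext i j
  rw [expAd_diagonal_apply, expAd_diagonal_apply, expAd_diagonal_apply, add_mul, Complex.exp_add,
    mul_assoc]

theorem deltaUL_expAd_diagonal {n : ℕ} (k : ℕ) (t : ℂ) (d : Fin n → ℂ)
    (Y : Matrix (Fin n) (Fin n) ℂ) :
    deltaUL k (expAd t (Matrix.diagonal d) Y) = expAd t (Matrix.diagonal d) (deltaUL k Y) := by
  ext i j
  rw [expAd_diagonal_apply, deltaUL, deltaUL, Matrix.of_apply, Matrix.of_apply,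
    expAd_diagonal_apply]
  split_ifs <;> simp

/-- `expAd` is equivariant under conjugation. -/
theorem expAd_expAd {n : ℕ} (s t : ℂ) (D X Y : Matrix (Fin n) (Fin n) ℂ) :
    expAd s (expAd t D X) (expAd t D Y) = expAd t D (expAd s X Y) := by
  have hu : IsUnit (NormedSpace.exp (t • D)) := Matrix.isUnit_exp _
  have hdet := (Matrix.isUnit_iff_isUnit_det _).1 hu
  have h1 : NormedSpace.exp (s • expAd t D X) =
      NormedSpace.exp (t • D) * NormedSpace.exp (s • X) * (NormedSpace.exp (t • D))⁻¹ := by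
    rw [← Matrix.exp_conj _ _ hu, expAd, Matrix.exp_neg, mul_smul_comm, smul_mul_assoc]
  have h2 : NormedSpace.exp (-(s • expAd t D X)) =
      NormedSpace.exp (t • D) * NormedSpace.exp (-(s • X)) * (NormedSpace.exp (t • D))⁻¹ := by
    rw [← Matrix.exp_conj _ _ hu, expAd, Matrix.exp_neg (t • D), mul_neg, neg_mul, mul_smul_comm,
      smul_mul_assoc]
  rw [expAd, h1, h2]
  simp only [expAd, Matrix.exp_neg (t • D)]
  simp only [mul_assoc]
  rw [Matrix.nonsing_inv_mul_cancel_left _ _ hdet, Matrix.nonsing_inv_mul_cancel_left _ _ hdet]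

theorem deltaUL_eq_diagonal {n : ℕ} {k : ℕ} (hk : k ≤ 1) (A : Matrix (Fin n) (Fin n) ℂ) :
    deltaUL k A = Matrix.diagonal (fun i => A i i) := by
  ext i j
  rw [deltaUL, Matrix.of_apply, Matrix.diagonal_apply]
  have : ((i : ℕ) < k ∧ (j : ℕ) < k) ∨ i = j ↔ i = j := by
    refine or_iff_right_of_imp fun h => Fin.ext ?_
    omega
  simp only [this]
  split_ifs with h
  · rw [h]
  · rfl

theorem deltaUL_diag {n : ℕ} (k : ℕ) (A : Matrix (Fin n) (Fin n) ℂ) (i : Fin n) :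
    deltaUL k A i i = A i i := by simp [deltaUL]


theorem eventually_lt_re_logAtInfty {ρ : ℝ → ℝ} (hρ : Continuous ρ) (M : ℝ) :
    ∀ᶠ t in logAtInfty M, ρ t.im < t.re := by
  obtain ⟨B, hB⟩ := (isCompact_Icc (a := -M) (b := M)).bddAbove_image hρ.continuousOn
  have h1 : ∀ᶠ t in logAtInfty M, B < t.re :=
    (tendsto_comap.eventually (eventually_gt_atTop B)).filter_mono inf_le_left
  have h2 : ∀ᶠ t in logAtInfty M, |t.im| ≤ M :=
    mem_inf_of_right (mem_principal_self _)
  filter_upwards [h1, h2] with t h1 h2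
  exact (hB ⟨t.im, abs_le.1 h2, rfl⟩).trans_lt h1

theorem IsIsomonodromySolutionOn.one_add_exp_ne_zero {ρ : ℝ → ℝ}
    {Φ : (Fin 3 → ℂ) → Matrix (Fin 3) (Fin 3) ℂ} (h : IsIsomonodromySolutionOn (logDomain ρ) Φ)
    {t : ℂ} (ht : ρ t.im < t.re) : 1 + Complex.exp t ≠ 0 := by
  intro h0
  have hne := (h ![0, 0, t] ht).1.ne (show (2 : Fin 3) ≠ 0 by decide)
  apply hne
  rw [uOfLog_two, uOfLog_zero]
  simp
  linear_combination h0

/-- The shrinking solution depends on `z₁, z₂` by conjugation only, its diagonal is constant, and its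
regularized limit at `z₁ = z₂ = 1` is the boundary value itself. -/
theorem IsShrinkingSolution.reduction {Φ₀ : Matrix (Fin 3) (Fin 3) ℂ} {ρ : ℝ → ℝ}
    {Φ : (Fin 3 → ℂ) → Matrix (Fin 3) (Fin 3) ℂ} (hΦ : IsShrinkingSolution Φ₀ ρ Φ) (hρ : Continuous ρ) :
    (∀ a b t : ℂ, ρ t.im < t.re → Φ ![a, b, t] =
      expAd (-(a + b)) (Matrix.diagonal fun i => Φ₀ i i) (Φ ![0, 0, t])) ∧
    (∀ t : ℂ, ρ t.im < t.re → ∀ i, Φ ![0, 0, t] i i = Φ₀ i i) ∧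
    ∀ M : ℝ, Tendsto (fun t => deltaUL 2 (Φ ![0, 0, t])) (logAtInfty M) (𝓝 (deltaUL 2 Φ₀)) ∧
      Tendsto (fun t => expAd t (deltaUL 2 Φ₀) (Φ ![0, 0, t])) (logAtInfty M) (𝓝 Φ₀) := by
  obtain ⟨-, hsol, Φ₂, Φ₁, hlim⟩ := hΦ
  have entry {k : ℕ} {F : ℂ → Matrix (Fin 3) (Fin 3) ℂ} {A : Matrix (Fin 3) (Fin 3) ℂ} {M : ℝ}
      (h : Tendsto (fun t => deltaUL k (F t)) (logAtInfty M) (𝓝 (deltaUL k A))) (i : Fin 3) :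
      Tendsto (fun t => F t i i) (logAtInfty M) (𝓝 (A i i)) := by
    have := tendsto_pi_nhds.1 (tendsto_pi_nhds.1 h i) i
    simpa only [deltaUL_diag] using this
  have (M : ℝ) : (logAtInfty |M|).NeBot := logAtInfty_neBot (abs_nonneg M)
  -- the diagonal is constant
  have hconst0 (a b t : ℂ) (ht : ρ t.im < t.re) (i : Fin 3) :
      Φ ![a, b, t] i i = Φ ![0, b, t] i i := by
    refine is_const_of_deriv_eq_zero (f := fun s => Φ ![s, b, t] i i)
      (fun s => (hsol.hasDerivAt_zero s b ht i i).differentiableAt) (fun s => ?_) a 0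
    rw [(hsol.hasDerivAt_zero s b ht i i).deriv]; simp
  have hconst1 (a b t : ℂ) (ht : ρ t.im < t.re) (i : Fin 3) :
      Φ ![a, b, t] i i = Φ ![a, 0, t] i i := by
    refine is_const_of_deriv_eq_zero (f := fun s => Φ ![a, s, t] i i)
      (fun s => (hsol.hasDerivAt_one a s ht i i).differentiableAt) (fun s => ?_) b 0
    rw [(hsol.hasDerivAt_one a s ht i i).deriv]; simp
  have hdiag2 (a b : ℂ) (i : Fin 3) : Φ₂ a b i i = Φ₂ 0 0 i i := by
    refine tendsto_nhds_unique (entry ((hlim |(0 : ℝ)|).1 a b).1 i) ?_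
    refine (entry ((hlim |(0 : ℝ)|).1 0 0).1 i).congr' ?_
    filter_upwards [eventually_lt_re_logAtInfty hρ _] with t ht
    rw [hconst0 a b t ht, hconst1 0 b t ht]
  have hdiag1 (a : ℂ) (i : Fin 3) : Φ₁ a i i = Φ₂ 0 0 i i := by
    refine tendsto_nhds_unique (entry ((hlim |(0 : ℝ)|).2.1 a).1 i) ?_
    simp only [hdiag2]
    exact tendsto_const_nhds
  have hdiag0 (i : Fin 3) : Φ₀ i i = Φ₂ 0 0 i i := by
    refine tendsto_nhds_unique (entry (hlim |(0 : ℝ)|).2.2.1 i) ?_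
    simp only [hdiag1]
    exact tendsto_const_nhds
  have hdiag (t : ℂ) (ht : ρ t.im < t.re) (i : Fin 3) : Φ ![0, 0, t] i i = Φ₀ i i := by
    rw [hdiag0]
    refine eq_of_hasDerivAt_zero_of_tendsto (f := fun t => Φ ![0, 0, t] i i) le_rfl
      (fun s hs => ?_) (entry ((hlim |t.im|).1 0 0).1 i)
    have ht' : ρ (t + s).im < (t + s).re := by simp; linarith
    refine (hsol.hasDerivAt_two ht'
      (inv_mul_cancel₀ (hsol.one_add_exp_ne_zero ht')) i i).congr_deriv ?_
    rw [comm_flowMatrix]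
    fin_cases i <;> simp
  have hdiag' (a b t : ℂ) (ht : ρ t.im < t.re) (i : Fin 3) : Φ ![a, b, t] i i = Φ₀ i i := by
    rw [hconst0 a b t ht, hconst1 0 b t ht, hdiag t ht]
  -- hence the dependence on `z₁` and `z₂` solves a linear equation
  have hshape (a b t : ℂ) (ht : ρ t.im < t.re) : Φ ![a, b, t] =
      expAd (-(a + b)) (Matrix.diagonal fun i => Φ₀ i i) (Φ ![0, 0, t]) := by
    ext i j
    rw [expAd_diagonal_apply]
    have hexp (s : ℂ) : HasDerivAt (fun s => Complex.exp (s * (Φ₀ i i - Φ₀ j j)))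
        (Complex.exp (s * (Φ₀ i i - Φ₀ j j)) * (Φ₀ i i - Φ₀ j j)) s := by
      simpa using ((hasDerivAt_id s).mul_const (Φ₀ i i - Φ₀ j j)).cexp
    have h0 : ∀ s, HasDerivAt (fun s => Complex.exp (s * (Φ₀ i i - Φ₀ j j)) * Φ ![s, b, t] i j)
        0 s := fun s => ((hexp s).mul (hsol.hasDerivAt_zero s b ht i j)).congr_deriv (by
          rw [hdiag' s b t ht, hdiag' s b t ht]; ring)
    have h1 : ∀ s, HasDerivAt (fun s => Complex.exp (s * (Φ₀ i i - Φ₀ j j)) * Φ ![0, s, t] i j)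
        0 s := fun s => ((hexp s).mul (hsol.hasDerivAt_one 0 s ht i j)).congr_deriv (by
          rw [hdiag' 0 s t ht, hdiag' 0 s t ht]; ring)
    have e0 := is_const_of_deriv_eq_zero (fun s => (h0 s).differentiableAt)
      (fun s => (h0 s).deriv) a 0
    have e1 := is_const_of_deriv_eq_zero (fun s => (h1 s).differentiableAt)
      (fun s => (h1 s).deriv) b 0
    simp only [zero_mul, Complex.exp_zero, one_mul] at e0 e1
    rw [← e1, ← e0, ← mul_assoc, ← mul_assoc, ← Complex.exp_add, ← Complex.exp_add]
    ring_nf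
    simp
  refine ⟨hshape, hdiag, ?_⟩
  generalize hD : (Matrix.diagonal fun i => Φ₀ i i) = D at hshape
  have hcont (t : ℂ) : Continuous fun Y : Matrix (Fin 3) (Fin 3) ℂ => expAd t D Y := by
    unfold expAd; fun_prop
  have hδ2 (a b : ℂ) : deltaUL 2 (Φ₂ a b) = expAd (-(a + b)) D (deltaUL 2 (Φ₂ 0 0)) := by
    refine tendsto_nhds_unique ((hlim |(0 : ℝ)|).1 a b).1 ?_
    refine (((hcont (-(a + b))).tendsto _).comp ((hlim |(0 : ℝ)|).1 0 0).1).congr' ?_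
    filter_upwards [eventually_lt_re_logAtInfty hρ _] with t ht
    rw [hshape a b t ht, ← hD, deltaUL_expAd_diagonal]; rfl
  have hΦ2 (a b : ℂ) : Φ₂ a b = expAd (-(a + b)) D (Φ₂ 0 0) := by
    refine tendsto_nhds_unique ((hlim |(0 : ℝ)|).1 a b).2 ?_
    refine (((hcont (-(a + b))).tendsto _).comp ((hlim |(0 : ℝ)|).1 0 0).2).congr' ?_
    filter_upwards [eventually_lt_re_logAtInfty hρ _] with t ht
    rw [hshape a b t ht, hδ2 a b, expAd_expAd]; rfl
  have hΦ1 (a : ℂ) : Φ₁ a = expAd (-a) D (Φ₂ 0 0) := by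
    refine tendsto_nhds_unique ((hlim |(0 : ℝ)|).2.1 a).2 (tendsto_const_nhds.congr fun b => ?_)
    rw [deltaUL_eq_diagonal le_rfl, hΦ2 a b, ← hD]
    simp only [hdiag1, ← hdiag0]
    rw [expAd_expAd_diagonal]
    congr 1; ring
  have hΦ0 : Φ₀ = Φ₂ 0 0 := by
    refine tendsto_nhds_unique (hlim |(0 : ℝ)|).2.2.2 (tendsto_const_nhds.congr fun a => ?_)
    rw [deltaUL_eq_diagonal zero_le_one, hΦ1, ← hD, expAd_expAd_diagonal, add_neg_cancel]
    simp [expAd]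
  intro M
  have := (hlim M).1 0 0
  rwa [← hΦ0] at this

theorem harnadD_expAd_diagonal (l : Fin 3 → ℂ) (t : ℂ) (d : Fin 3 → ℂ)
    (A : Matrix (Fin 3) (Fin 3) ℂ) :
    harnadD l (expAd t (Matrix.diagonal d) A) = harnadD l A := by
  have h := Complex.exp_add (t * (d 0 - d 1)) (t * (d 1 - d 0))
  rw [show t * (d 0 - d 1) + t * (d 1 - d 0) = 0 by ring, Complex.exp_zero] at h
  simp only [harnadD, expAd_diagonal_apply, sub_self, mul_zero, Complex.exp_zero, one_mul]
  linear_combination (A 0 1 * A 1 0) * h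

theorem expAd_diagonal_apply_mul_swap (t : ℂ) (d : Fin 3 → ℂ) (A : Matrix (Fin 3) (Fin 3) ℂ) :
    expAd t (Matrix.diagonal d) A 0 2 * expAd t (Matrix.diagonal d) A 2 0 = A 0 2 * A 2 0 := by
  have h := Complex.exp_add (t * (d 0 - d 2)) (t * (d 2 - d 0))
  rw [show t * (d 0 - d 2) + t * (d 2 - d 0) = 0 by ring, Complex.exp_zero] at h
  simp only [expAd_diagonal_apply]
  linear_combination -(A 0 2 * A 2 0) * h

theorem harnadV_expAd_diagonal (l : Fin 3 → ℂ) (t : ℂ) (d : Fin 3 → ℂ)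
    (A : Matrix (Fin 3) (Fin 3) ℂ) :
    harnadV l (expAd t (Matrix.diagonal d) A) = harnadV l A := by
  have h : Complex.exp (t * (d 0 - d 1)) * Complex.exp (t * (d 1 - d 2)) *
      Complex.exp (t * (d 2 - d 0)) = 1 := by
    rw [← Complex.exp_add, ← Complex.exp_add, ← Complex.exp_zero]
    congr 1; ring
  have h' := expAd_diagonal_apply_mul_swap t d A
  rw [harnadV, harnadV, harnadD_expAd_diagonal, mul_assoc (l 1 - _), h']
  simp only [expAd_diagonal_apply, sub_self, mul_zero, Complex.exp_zero, one_mul]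
  congr 1
  linear_combination (A 0 1 * A 1 2 * A 2 0) * h

theorem harnadR_expAd_diagonal (l : Fin 3 → ℂ) (t : ℂ) (d : Fin 3 → ℂ)
    (A : Matrix (Fin 3) (Fin 3) ℂ) :
    harnadR l (expAd t (Matrix.diagonal d) A) = harnadR l A := by
  rw [harnadR, harnadR, harnadV_expAd_diagonal, expAd_diagonal_apply_mul_swap]
  simp only [expAd_diagonal_apply, sub_self, mul_zero, Complex.exp_zero, one_mul]

theorem harnadY_expAd_diagonal (l : Fin 3 → ℂ) (t : ℂ) (d : Fin 3 → ℂ)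
    (A : Matrix (Fin 3) (Fin 3) ℂ) (x : ℂ) :
    harnadY l (expAd t (Matrix.diagonal d) A) x = harnadY l A x := by
  rw [harnadY, harnadY, harnadR_expAd_diagonal]

theorem harnadDefined_expAd_diagonal (l : Fin 3 → ℂ) (t : ℂ) (d : Fin 3 → ℂ)
    (A : Matrix (Fin 3) (Fin 3) ℂ) (x : ℂ) :
    HarnadDefined l (expAd t (Matrix.diagonal d) A) x ↔ HarnadDefined l A x := by
  rw [HarnadDefined, HarnadDefined, harnadD_expAd_diagonal, harnadV_expAd_diagonal,
    harnadR_expAd_diagonal, expAd_diagonal_apply]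
  simp

/-! ### Asymptotics near `z₃ = ∞` -/

/-- The exponential of a linear combination of a complete system of orthogonal idempotents. -/
theorem exp_eq_of_idempotents {n : ℕ} {P Q E : Matrix (Fin n) (Fin n) ℂ} (hP : P * P = P)
    (hQ : Q * Q = Q) (hE : E * E = E) (hPQ : P * Q = 0) (hQP : Q * P = 0) (hPE : P * E = 0)
    (hEP : E * P = 0) (hQE : Q * E = 0) (hEQ : E * Q = 0) (h1 : P + Q + E = 1) (a b c : ℂ) :
    NormedSpace.exp (a • P + b • Q + c • E) =
      Complex.exp a • P + Complex.exp b • Q + Complex.exp c • E := by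
  have hpow (n : ℕ) : (a • P + b • Q + c • E) ^ n = a ^ n • P + b ^ n • Q + c ^ n • E := by
    induction n with
    | zero => simp [h1]
    | succ n ih =>
      rw [pow_succ, ih]
      simp [add_mul, mul_add, hP, hQ, hE, hPQ, hQP, hPE, hEP, hQE, hEQ, smul_smul, pow_succ']
  have hs (a : ℂ) : HasSum (fun n : ℕ => ((n.factorial : ℂ)⁻¹ * a ^ n)) (Complex.exp a) := by
    rw [Complex.exp_eq_exp_ℂ]
    simpa using NormedSpace.exp_series_hasSum_exp' (𝕂 := ℂ) a
  have := (((hs a).smul_const P).add ((hs b).smul_const Q)).add ((hs c).smul_const E)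
  rw [NormedSpace.exp_eq_tsum ℂ, ← this.tsum_eq]
  refine tsum_congr fun n => ?_
  rw [hpow, smul_add, smul_add, smul_smul, smul_smul, smul_smul]

theorem eventually_logAtInfty {M : ℝ} {p : ℂ → Prop} :
    (∀ᶠ t in logAtInfty M, p t) ↔ ∃ T, ∀ t : ℂ, T ≤ t.re → |t.im| ≤ M → p t := by
  rw [logAtInfty, eventually_inf_principal, eventually_comap, eventually_atTop]
  constructor
  · rintro ⟨T, h⟩; exact ⟨T, fun t h1 h2 => h _ h1 t rfl h2⟩
  · rintro ⟨T, h⟩; exact ⟨T, fun s h1 t ht h2 => h t (ht ▸ h1) h2⟩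

theorem norm_cexp_mul (μ t : ℂ) : ‖Complex.exp (μ * t)‖ = Real.exp (μ.re * t.re - μ.im * t.im) := by
  rw [Complex.norm_exp, Complex.mul_re]

theorem tendsto_cexp_mul_logAtInfty {μ : ℂ} (hμ : μ.re < 0) (M : ℝ) :
    Tendsto (fun t => Complex.exp (μ * t)) (logAtInfty M) (𝓝 0) := by
  rw [tendsto_zero_iff_norm_tendsto_zero]
  have h0 : Tendsto (fun t : ℂ => t.re) (logAtInfty M) atTop := tendsto_comap.mono_left inf_le_left
  have h1 : Tendsto (fun t : ℂ => Real.exp (μ.re * t.re + |μ.im| * M)) (logAtInfty M) (𝓝 0) :=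
    Real.tendsto_exp_atBot.comp (tendsto_atBot_add_const_right _ _ (h0.const_mul_atTop_of_neg hμ))
  refine squeeze_zero' (.of_forall fun t => norm_nonneg _) ?_ h1
  filter_upwards [mem_inf_of_right (mem_principal_self _)] with t ht
  rw [norm_cexp_mul]
  refine Real.exp_le_exp.2 ?_
  have h2 : -(μ.im * t.im) ≤ |μ.im| * M := by
    refine (neg_le_abs _).trans ?_
    rw [abs_mul]
    exact mul_le_mul_of_nonneg_left ht (abs_nonneg _)
  linarith

/-- L'Hôpital's rule in a strip: the asymptotics `h' ~ K e^{μ t}` can be integrated from infinity along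
horizontal rays, uniformly in the strip. -/
theorem tendsto_exp_mul_of_hasDerivAt {h h' : ℂ → ℂ} {μ K : ℂ} {M : ℝ} (hμ : μ.re < 0)
    (hd : ∀ᶠ t in logAtInfty M, HasDerivAt h (h' t) t) (h0 : Tendsto h (logAtInfty M) (𝓝 0))
    (hK : Tendsto (fun t => Complex.exp (-μ * t) * h' t) (logAtInfty M) (𝓝 K)) :
    Tendsto (fun t => Complex.exp (-μ * t) * h t) (logAtInfty M) (𝓝 (K / μ)) := by
  have hμ0 : μ ≠ 0 := by rintro rfl; simp at hμ
  rw [Metric.tendsto_nhds]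
  intro ε hε
  have hr : 0 < -μ.re := by linarith
  have hK' := (Metric.tendsto_nhds.1 hK) (ε / 2 * -μ.re) (by positivity)
  obtain ⟨T, hT⟩ := eventually_logAtInfty.1 (hd.and hK')
  refine eventually_logAtInfty.2 ⟨T, fun z hz hzM => ?_⟩
  have hee (t : ℂ) : Complex.exp (μ * t) * Complex.exp (-μ * t) = 1 := by
    rw [← Complex.exp_add]; simp
  set k : ℝ → ℂ := fun s => h (z + s) - K / μ * Complex.exp (μ * (z + s)) with hk
  have hkd (s : ℝ) (hs : 0 ≤ s) : HasDerivAt k (h' (z + s) - K * Complex.exp (μ * (z + s))) s := by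
    have h1 : HasDerivAt (fun s : ℝ => z + (s : ℂ)) 1 s :=
      (HasDerivAt.ofReal_comp (hasDerivAt_id s)).const_add z
    have h2 := (hT (z + s) (by simp; linarith) (by simpa)).1.comp s h1
    have h3 := ((h1.const_mul μ).cexp).const_mul (K / μ)
    refine (HasDerivAt.sub (f := fun s : ℝ => h (z + s)) h2 h3).congr_deriv ?_
    field_simp
  have hbound (s : ℝ) (hs : 0 ≤ s) : ‖h' (z + s) - K * Complex.exp (μ * (z + s))‖ ≤
      ε / 2 * -μ.re * ‖Complex.exp (μ * z)‖ * Real.exp (μ.re * s) := by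
    have h1 := (hT (z + s) (by simp; linarith) (by simpa)).2
    rw [dist_eq_norm] at h1
    have h2 : h' (z + s) - K * Complex.exp (μ * (z + s)) =
        (Complex.exp (-μ * (z + s)) * h' (z + s) - K) * Complex.exp (μ * (z + s)) := by
      linear_combination (-h' (z + s)) * hee (z + s)
    have h3 : ‖Complex.exp (μ * (z + s))‖ = ‖Complex.exp (μ * z)‖ * Real.exp (μ.re * s) := by
      rw [norm_cexp_mul, norm_cexp_mul, ← Real.exp_add]
      congr 1; simp; ring
    rw [h2, norm_mul, h3, ← mul_assoc]
    gcongr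
  have hB (s : ℝ) : HasDerivAt (fun s => ε / 2 * ‖Complex.exp (μ * z)‖ * (1 - Real.exp (μ.re * s)))
      (ε / 2 * -μ.re * ‖Complex.exp (μ * z)‖ * Real.exp (μ.re * s)) s := by
    have := ((((hasDerivAt_id s).const_mul μ.re).exp).const_sub 1).const_mul
      (ε / 2 * ‖Complex.exp (μ * z)‖)
    refine this.congr_deriv ?_
    simp; ring
  have hle (s : ℝ) (hs : 0 ≤ s) : ‖k s - k 0‖ ≤ ε / 2 * ‖Complex.exp (μ * z)‖ := by
    have := image_norm_le_of_norm_deriv_right_le_deriv_boundary (f := fun s => k s - k 0)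
      (a := 0) (b := s)
      (B := fun s => ε / 2 * ‖Complex.exp (μ * z)‖ * (1 - Real.exp (μ.re * s)))
      (fun x hx => ((hkd x hx.1).sub_const _).continuousAt.continuousWithinAt)
      (fun x hx => ((hkd x hx.1).sub_const _).hasDerivWithinAt) (by simp) hB
      (fun x hx => hbound x hx.1) ⟨hs, le_rfl⟩
    refine this.trans (mul_le_of_le_one_right (by positivity) ?_)
    linarith [Real.exp_pos (μ.re * s)]
  have hk0 : Tendsto k atTop (𝓝 0) := by
    have hz := tendsto_add_ofReal_logAtInfty z hzM
    have := (h0.comp hz).sub (((tendsto_cexp_mul_logAtInfty hμ M).comp hz).const_mul (K / μ))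
    simpa [hk, Function.comp_def] using this
  have hfin : ‖k 0‖ ≤ ε / 2 * ‖Complex.exp (μ * z)‖ := by
    have h1 : Tendsto (fun s => ‖k s - k 0‖) atTop (𝓝 ‖k 0‖) := by
      simpa using (hk0.sub_const (k 0)).norm
    exact le_of_tendsto h1 ((eventually_ge_atTop 0).mono hle)
  have hfac : Complex.exp (-μ * z) * h z - K / μ = Complex.exp (-μ * z) * k 0 := by
    simp only [hk, Complex.ofReal_zero, add_zero]
    linear_combination (K / μ) * hee z
  rw [dist_eq_norm, hfac, norm_mul]
  have h1 := congrArg norm (hee z)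
  rw [norm_mul, norm_one] at h1
  calc ‖Complex.exp (-μ * z)‖ * ‖k 0‖ ≤ ‖Complex.exp (-μ * z)‖ * (ε / 2 * ‖Complex.exp (μ * z)‖) := by
        gcongr
    _ = ε / 2 := by linear_combination (ε / 2) * h1
    _ < ε := half_lt_self hε

/-- The spectral projection of `deltaUL 2 A`, for the eigenvalue `m` of the upper left block, where
`m'` is the other one. -/
noncomputable def blockProj (m m' : ℂ) (A : Matrix (Fin 3) (Fin 3) ℂ) : Matrix (Fin 3) (Fin 3) ℂ :=
  (m - m')⁻¹ • !![A 0 0 - m', A 0 1, 0; A 1 0, A 1 1 - m', 0; 0, 0, 0]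

section blockProj
variable {A : Matrix (Fin 3) (Fin 3) ℂ} {m m' : ℂ}

theorem blockProj_mul_self (hne : m ≠ m') (htr : A 0 0 + A 1 1 = m + m')
    (hdet : A 0 0 * A 1 1 - A 0 1 * A 1 0 = m * m') :
    blockProj m m' A * blockProj m m' A = blockProj m m' A := by
  have h1 : m - m' ≠ 0 := sub_ne_zero.2 hne
  obtain ⟨a, ha⟩ : ∃ a, a = A 0 0 := ⟨_, rfl⟩
  have e11 : A 1 1 = m + m' - a := by linear_combination htr + ha
  rw [e11, ← ha] at hdet
  ext i j
  simp only [Matrix.mul_apply, Fin.sum_univ_three]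
  fin_cases i <;> fin_cases j <;> simp [blockProj, e11, ← ha] <;> field_simp
  · linear_combination -hdet
  · ring
  · ring
  · linear_combination -hdet

theorem blockProj_mul_swap (hne : m ≠ m') (htr : A 0 0 + A 1 1 = m + m')
    (hdet : A 0 0 * A 1 1 - A 0 1 * A 1 0 = m * m') :
    blockProj m m' A * blockProj m' m A = 0 := by
  have h1 : m - m' ≠ 0 := sub_ne_zero.2 hne
  have h2 : m' - m ≠ 0 := sub_ne_zero.2 hne.symm
  obtain ⟨a, ha⟩ : ∃ a, a = A 0 0 := ⟨_, rfl⟩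
  have e11 : A 1 1 = m + m' - a := by linear_combination htr + ha
  rw [e11, ← ha] at hdet
  ext i j
  simp only [Matrix.mul_apply, Fin.sum_univ_three]
  fin_cases i <;> fin_cases j <;> simp [blockProj, e11, ← ha] <;> field_simp
  · linear_combination -hdet
  · ring
  · ring
  · linear_combination -hdet

theorem blockProj_mul_single (m m' : ℂ) (A : Matrix (Fin 3) (Fin 3) ℂ) :
    blockProj m m' A * Matrix.single 2 2 1 = 0 := by
  ext i j
  simp only [Matrix.mul_apply, Fin.sum_univ_three]
  fin_cases i <;> fin_cases j <;> simp [blockProj]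

theorem single_mul_blockProj (m m' : ℂ) (A : Matrix (Fin 3) (Fin 3) ℂ) :
    Matrix.single 2 2 1 * blockProj m m' A = 0 := by
  ext i j
  simp only [Matrix.mul_apply, Fin.sum_univ_three]
  fin_cases i <;> fin_cases j <;> simp [blockProj]

theorem blockProj_apply_two (m m' : ℂ) (A : Matrix (Fin 3) (Fin 3) ℂ) (k : Fin 3) :
    blockProj m m' A k 2 = 0 := by
  fin_cases k <;> simp [blockProj]

theorem blockProj_two_apply (m m' : ℂ) (A : Matrix (Fin 3) (Fin 3) ℂ) (k : Fin 3) :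
    blockProj m m' A 2 k = 0 := by
  fin_cases k <;> simp [blockProj]

end blockProj

theorem exp_smul_deltaUL {A : Matrix (Fin 3) (Fin 3) ℂ} {m₁ m₂ : ℂ} (hne : m₁ ≠ m₂)
    (htr : A 0 0 + A 1 1 = m₁ + m₂) (hdet : A 0 0 * A 1 1 - A 0 1 * A 1 0 = m₁ * m₂) (t : ℂ) :
    NormedSpace.exp (t • deltaUL 2 A) = Complex.exp (t * m₁) • blockProj m₁ m₂ A +
      Complex.exp (t * m₂) • blockProj m₂ m₁ A +
      Complex.exp (t * A 2 2) • Matrix.single 2 2 1 := by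
  have h1 : m₁ - m₂ ≠ 0 := sub_ne_zero.2 hne
  have hinv : (m₂ - m₁)⁻¹ = -(m₁ - m₂)⁻¹ := by rw [← neg_sub, inv_neg]
  have hA : t • deltaUL 2 A = (t * m₁) • blockProj m₁ m₂ A + (t * m₂) • blockProj m₂ m₁ A +
      (t * A 2 2) • Matrix.single 2 2 1 := by
    ext i j
    fin_cases i <;> fin_cases j <;> simp [deltaUL, blockProj, hinv] <;> field_simp <;> ring
  have hsum : blockProj m₁ m₂ A + blockProj m₂ m₁ A + Matrix.single 2 2 1 = 1 := by
    ext i j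
    fin_cases i <;> fin_cases j <;> simp [blockProj, hinv] <;> field_simp <;> ring
  have htr' : A 0 0 + A 1 1 = m₂ + m₁ := by rw [htr, add_comm]
  have hdet' : A 0 0 * A 1 1 - A 0 1 * A 1 0 = m₂ * m₁ := by rw [hdet, mul_comm]
  rw [hA]
  exact exp_eq_of_idempotents (blockProj_mul_self hne htr hdet)
    (blockProj_mul_self hne.symm htr' hdet') (by simp) (blockProj_mul_swap hne htr hdet)
    (blockProj_mul_swap hne.symm htr' hdet') (blockProj_mul_single _ _ _)
    (single_mul_blockProj _ _ _) (blockProj_mul_single _ _ _) (single_mul_blockProj _ _ _) hsum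
    _ _ _

section Limits
variable {A : Matrix (Fin 3) (Fin 3) ℂ} {Ψ : ℂ → Matrix (Fin 3) (Fin 3) ℂ} {m₁ m₂ : ℂ} {M : ℝ}

theorem eq_exp_mul_expAd {n : ℕ} (t : ℂ) (X Y : Matrix (Fin n) (Fin n) ℂ) :
    Y = NormedSpace.exp ((-t) • X) * expAd t X Y * NormedSpace.exp (t • X) := by
  have hu : IsUnit (NormedSpace.exp (t • X)) := Matrix.isUnit_exp _
  have hdet := (Matrix.isUnit_iff_isUnit_det _).1 hu
  rw [neg_smul, Matrix.exp_neg, expAd, Matrix.exp_neg]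
  simp only [mul_assoc]
  rw [Matrix.nonsing_inv_mul_cancel_left _ _ hdet, Matrix.nonsing_inv_mul _ hdet, mul_one]

theorem tendsto_exp_mul_col (hσ : 0 < (m₁ - m₂).re)
    (htr : A 0 0 + A 1 1 = m₁ + m₂) (hdet : A 0 0 * A 1 1 - A 0 1 * A 1 0 = m₁ * m₂)
    (h : Tendsto (fun t => expAd t (deltaUL 2 A) (Ψ t)) (logAtInfty M) (𝓝 A))
    {i : Fin 3} (hi : i ≠ 2) :
    Tendsto (fun t => Complex.exp (t * (m₂ - A 2 2)) * Ψ t i 2) (logAtInfty M)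
      (𝓝 ((blockProj m₂ m₁ A * A) i 2)) := by
  have hne : m₁ ≠ m₂ := by rintro rfl; simp at hσ
  have hS := tendsto_cexp_mul_logAtInfty (μ := -(m₁ - m₂)) (by simpa using hσ) M
  have h1 : Tendsto (fun t => (Complex.exp (-(m₁ - m₂) * t) • blockProj m₁ m₂ A +
      blockProj m₂ m₁ A) * expAd t (deltaUL 2 A) (Ψ t)) (logAtInfty M)
      (𝓝 (((0 : ℂ) • blockProj m₁ m₂ A + blockProj m₂ m₁ A) * A)) :=
    ((hS.smul_const (blockProj m₁ m₂ A)).add_const (blockProj m₂ m₁ A)).mul h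
  rw [zero_smul, zero_add] at h1
  refine (tendsto_pi_nhds.1 (tendsto_pi_nhds.1 h1 i) 2).congr fun t => ?_
  conv_rhs => rw [eq_exp_mul_expAd t (deltaUL 2 A) (Ψ t), exp_smul_deltaUL hne htr hdet,
    exp_smul_deltaUL hne htr hdet]
  generalize expAd t (deltaUL 2 A) (Ψ t) = X
  have e1 : Complex.exp (-(m₁ - m₂) * t) =
      Complex.exp (t * (m₂ - A 2 2)) * Complex.exp (-t * m₁) * Complex.exp (t * A 2 2) := by
    rw [← Complex.exp_add, ← Complex.exp_add]; congr 1; ring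
  have e2 : 1 = Complex.exp (t * (m₂ - A 2 2)) * Complex.exp (-t * m₂) * Complex.exp (t * A 2 2) := by
    rw [← Complex.exp_add, ← Complex.exp_add, ← Complex.exp_zero]; congr 1; ring
  rw [e1]
  simp only [Matrix.mul_apply, Fin.sum_univ_three, Matrix.add_apply, Matrix.smul_apply,
    blockProj_apply_two, Matrix.single_apply_same, smul_eq_mul]
  have h2 (k : Fin 3) (hk : k ≠ 2) : Matrix.single (2 : Fin 3) (2 : Fin 3) (1 : ℂ) i k = 0 :=
    Matrix.single_apply_of_ne _ _ _ _ _ (by tauto)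
  have h3 (k : Fin 3) (hk : k ≠ 2) : Matrix.single (2 : Fin 3) (2 : Fin 3) (1 : ℂ) k 2 = 0 :=
    Matrix.single_apply_of_ne _ _ _ _ _ (by tauto)
  have h4 : Matrix.single (2 : Fin 3) (2 : Fin 3) (1 : ℂ) i 2 = 0 :=
    Matrix.single_apply_of_ne _ _ _ _ _ (by tauto)
  rw [h2 0 (by decide), h2 1 (by decide), h3 0 (by decide), h3 1 (by decide), h4]
  linear_combination (blockProj m₂ m₁ A i 0 * X 0 2 + blockProj m₂ m₁ A i 1 * X 1 2) * e2

theorem tendsto_exp_mul_row (hσ : 0 < (m₁ - m₂).re)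
    (htr : A 0 0 + A 1 1 = m₁ + m₂) (hdet : A 0 0 * A 1 1 - A 0 1 * A 1 0 = m₁ * m₂)
    (h : Tendsto (fun t => expAd t (deltaUL 2 A) (Ψ t)) (logAtInfty M) (𝓝 A))
    {j : Fin 3} (hj : j ≠ 2) :
    Tendsto (fun t => Complex.exp (t * (A 2 2 - m₁)) * Ψ t 2 j) (logAtInfty M)
      (𝓝 ((A * blockProj m₁ m₂ A) 2 j)) := by
  have hne : m₁ ≠ m₂ := by rintro rfl; simp at hσ
  have hS := tendsto_cexp_mul_logAtInfty (μ := -(m₁ - m₂)) (by simpa using hσ) M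
  have h1 : Tendsto (fun t => expAd t (deltaUL 2 A) (Ψ t) * (Complex.exp (-(m₁ - m₂) * t) •
      blockProj m₂ m₁ A + blockProj m₁ m₂ A)) (logAtInfty M)
      (𝓝 (A * ((0 : ℂ) • blockProj m₂ m₁ A + blockProj m₁ m₂ A))) :=
    h.mul ((hS.smul_const (blockProj m₂ m₁ A)).add_const (blockProj m₁ m₂ A))
  rw [zero_smul, zero_add] at h1
  refine (tendsto_pi_nhds.1 (tendsto_pi_nhds.1 h1 2) j).congr fun t => ?_
  conv_rhs => rw [eq_exp_mul_expAd t (deltaUL 2 A) (Ψ t), exp_smul_deltaUL hne htr hdet,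
    exp_smul_deltaUL hne htr hdet]
  generalize expAd t (deltaUL 2 A) (Ψ t) = X
  have e1 : Complex.exp (-(m₁ - m₂) * t) =
      Complex.exp (t * (A 2 2 - m₁)) * Complex.exp (-t * A 2 2) * Complex.exp (t * m₂) := by
    rw [← Complex.exp_add, ← Complex.exp_add]; congr 1; ring
  have e2 : 1 = Complex.exp (t * (A 2 2 - m₁)) * Complex.exp (-t * A 2 2) * Complex.exp (t * m₁) := by
    rw [← Complex.exp_add, ← Complex.exp_add, ← Complex.exp_zero]; congr 1; ring
  rw [e1]
  simp only [Matrix.mul_apply, Fin.sum_univ_three, Matrix.add_apply, Matrix.smul_apply,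
    blockProj_two_apply, Matrix.single_apply_same, smul_eq_mul]
  have h2 (k : Fin 3) (hk : k ≠ 2) : Matrix.single (2 : Fin 3) (2 : Fin 3) (1 : ℂ) 2 k = 0 :=
    Matrix.single_apply_of_ne _ _ _ _ _ (by tauto)
  have h3 (k : Fin 3) (hk : k ≠ 2) : Matrix.single (2 : Fin 3) (2 : Fin 3) (1 : ℂ) k j = 0 :=
    Matrix.single_apply_of_ne _ _ _ _ _ (by tauto)
  have h4 : Matrix.single (2 : Fin 3) (2 : Fin 3) (1 : ℂ) 2 j = 0 :=
    Matrix.single_apply_of_ne _ _ _ _ _ (by tauto)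
  rw [h2 0 (by decide), h2 1 (by decide), h3 0 (by decide), h3 1 (by decide), h4]
  linear_combination (X 2 0 * blockProj m₁ m₂ A 0 j + X 2 1 * blockProj m₁ m₂ A 1 j) * e2

/-- Products of an entry of the last column with an entry of the last row grow like `z₃^σ`. -/
theorem tendsto_exp_mul_col_mul_row (hσ : 0 < (m₁ - m₂).re)
    (htr : A 0 0 + A 1 1 = m₁ + m₂) (hdet : A 0 0 * A 1 1 - A 0 1 * A 1 0 = m₁ * m₂)
    (h : Tendsto (fun t => expAd t (deltaUL 2 A) (Ψ t)) (logAtInfty M) (𝓝 A))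
    {i j : Fin 3} (hi : i ≠ 2) (hj : j ≠ 2) :
    Tendsto (fun t => Complex.exp (-(m₁ - m₂) * t) * (Ψ t i 2 * Ψ t 2 j)) (logAtInfty M)
      (𝓝 ((blockProj m₂ m₁ A * A) i 2 * (A * blockProj m₁ m₂ A) 2 j)) := by
  refine ((tendsto_exp_mul_col hσ htr hdet h hi).mul
    (tendsto_exp_mul_row hσ htr hdet h hj)).congr fun t => ?_
  rw [show -(m₁ - m₂) * t = t * (m₂ - A 2 2) + t * (A 2 2 - m₁) by ring, Complex.exp_add]
  ring

end Limits

/-! ### Leading terms of the invariants -/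

/-- The coefficient `C` in `Φ₁₃ Φ₃₁ ~ C z₃^σ`. -/
noncomputable def leadingCoeff (m₁ m₂ : ℂ) (A : Matrix (Fin 3) (Fin 3) ℂ) : ℂ :=
  (blockProj m₂ m₁ A * A) 0 2 * (A * blockProj m₁ m₂ A) 2 0

section Leading
variable {A : Matrix (Fin 3) (Fin 3) ℂ} {m₁ m₂ : ℂ}

/-- The right-hand side of the definition of `J` is four times the leading coefficient. -/
theorem four_mul_leadingCoeff (hne : m₁ ≠ m₂) (htr : A 0 0 + A 1 1 = m₁ + m₂) :
    4 * leadingCoeff m₁ m₂ A = A 0 2 * A 2 0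
      + 2 * (A 0 2 * A 2 1 * A 1 0 - A 0 1 * A 1 2 * A 2 0) / (m₁ - m₂)
      - ((A 0 0 - A 1 1) * A 0 2 + 2 * A 0 1 * A 1 2)
        * ((A 0 0 - A 1 1) * A 2 0 + 2 * A 2 1 * A 1 0) / (m₁ - m₂) ^ 2 := by
  have h1 : m₁ - m₂ ≠ 0 := sub_ne_zero.2 hne
  have hinv : (m₂ - m₁)⁻¹ = -(m₁ - m₂)⁻¹ := by rw [← neg_sub, inv_neg]
  obtain ⟨a, ha⟩ : ∃ a, a = A 0 0 := ⟨_, rfl⟩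
  have e11 : A 1 1 = m₁ + m₂ - a := by linear_combination htr + ha
  simp [leadingCoeff, blockProj, Matrix.mul_apply, Fin.sum_univ_three, hinv, e11, ← ha]
  field_simp
  ring

/-- The leading term of the last column is an eigenvector of the upper left block for `m₂`. -/
theorem apply_zero_one_mul_col (hne : m₁ ≠ m₂) (htr : A 0 0 + A 1 1 = m₁ + m₂)
    (hdet : A 0 0 * A 1 1 - A 0 1 * A 1 0 = m₁ * m₂) :
    A 0 1 * (blockProj m₂ m₁ A * A) 1 2 = (m₂ - A 0 0) * (blockProj m₂ m₁ A * A) 0 2 := by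
  have h2 : m₂ - m₁ ≠ 0 := sub_ne_zero.2 hne.symm
  obtain ⟨a, ha⟩ : ∃ a, a = A 0 0 := ⟨_, rfl⟩
  have e11 : A 1 1 = m₁ + m₂ - a := by linear_combination htr + ha
  rw [e11, ← ha] at hdet
  simp [blockProj, Matrix.mul_apply, Fin.sum_univ_three, e11, ← ha]
  field_simp
  linear_combination (-A 0 2) * hdet

/-- The leading term of the last row is a left eigenvector of the upper left block for `m₁`. -/
theorem row_mul_apply_one_zero (hne : m₁ ≠ m₂) (htr : A 0 0 + A 1 1 = m₁ + m₂)
    (hdet : A 0 0 * A 1 1 - A 0 1 * A 1 0 = m₁ * m₂) :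
    (A * blockProj m₁ m₂ A) 2 1 * A 1 0 = (m₁ - A 0 0) * (A * blockProj m₁ m₂ A) 2 0 := by
  have h2 : m₁ - m₂ ≠ 0 := sub_ne_zero.2 hne
  obtain ⟨a, ha⟩ : ∃ a, a = A 0 0 := ⟨_, rfl⟩
  have e11 : A 1 1 = m₁ + m₂ - a := by linear_combination htr + ha
  rw [e11, ← ha] at hdet
  simp [blockProj, Matrix.mul_apply, Fin.sum_univ_three, e11, ← ha]
  field_simp
  linear_combination (-A 2 0) * hdet

theorem col_mul_row_one (hne : m₁ ≠ m₂) (htr : A 0 0 + A 1 1 = m₁ + m₂)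
    (hdet : A 0 0 * A 1 1 - A 0 1 * A 1 0 = m₁ * m₂) :
    (blockProj m₂ m₁ A * A) 1 2 * (A * blockProj m₁ m₂ A) 2 1 = -leadingCoeff m₁ m₂ A := by
  have h0 := blockProj_mul_swap hne htr hdet
  have h1 : (A * blockProj m₁ m₂ A) * (blockProj m₂ m₁ A * A) = 0 := by
    rw [mul_assoc, ← mul_assoc (blockProj m₁ m₂ A), h0, zero_mul, mul_zero]
  have h2 := congrFun (congrFun h1 2) 2
  rw [Matrix.mul_apply, Fin.sum_univ_three] at h2
  have h3 : (A * blockProj m₁ m₂ A) 2 2 = 0 := by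
    simp [Matrix.mul_apply, blockProj_apply_two]
  rw [h3, Matrix.zero_apply] at h2
  rw [leadingCoeff]
  linear_combination h2

end Leading

/-- The denominators of `y` do not vanish for large `z₃`, and `R` is asymptotic to a multiple of
`z₃^(-σ)`.  If `l 1 = m₁`, then the limit of the denominator `D` of `v` and the leading coefficient of
its numerator both vanish.  Therefore `v` is rewritten as `b (adj)₁₁ / (q + (l 1 - f₂) b)`, where `adj` is
the adjugate of `l 1 - Φ`; both factors and the denominator have nonzero leading terms of order
`z₃^σ`. -/
theorem tendsto_harnad {A : Matrix (Fin 3) (Fin 3) ℂ} {Ψ : ℂ → Matrix (Fin 3) (Fin 3) ℂ}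
    {m₁ m₂ : ℂ} {M : ℝ} {l : Fin 3 → ℂ} (hσ : 0 < (m₁ - m₂).re) (hσ1 : (m₁ - m₂).re < 1)
    (htr : A 0 0 + A 1 1 = m₁ + m₂) (hdet : A 0 0 * A 1 1 - A 0 1 * A 1 0 = m₁ * m₂)
    (hδ : Tendsto (fun t => deltaUL 2 (Ψ t)) (logAtInfty M) (𝓝 (deltaUL 2 A)))
    (hlim : Tendsto (fun t => expAd t (deltaUL 2 A) (Ψ t)) (logAtInfty M) (𝓝 A))
    (hdiag : ∀ᶠ t in logAtInfty M, ∀ i, Ψ t i i = A i i)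
    (hder : ∀ᶠ t in logAtInfty M, HasDerivAt (fun t => Ψ t 0 1 * Ψ t 1 0)
      ((1 + Complex.exp t)⁻¹ * (Ψ t 0 1 * Ψ t 1 2 * Ψ t 2 0 - Ψ t 0 2 * Ψ t 2 1 * Ψ t 1 0)) t)
    (hchar : ∀ᶠ t in logAtInfty M, (Ψ t).charpoly = (Polynomial.X - Polynomial.C (l 0)) *
      (Polynomial.X - Polynomial.C (l 1)) * (Polynomial.X - Polynomial.C (l 2)))
    (hC : leadingCoeff m₁ m₂ A ≠ 0) (hl : l 1 ≠ m₂) :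
    (∀ᶠ t in logAtInfty M, harnadD l (Ψ t) ≠ 0 ∧ harnadV l (Ψ t) ≠ 0 ∧
      l 2 - Ψ t 0 0 + harnadV l (Ψ t) ≠ 0) ∧
    Tendsto (fun t => Complex.exp ((m₁ - m₂) * t) * harnadR l (Ψ t)) (logAtInfty M)
      (𝓝 ((l 1 - m₂) * (l 1 - m₂ + (l 2 - A 2 2)) / leadingCoeff m₁ m₂ A)) := by
  have hne : m₁ ≠ m₂ := by rintro rfl; simp at hσ
  have hlm : l 1 - m₂ ≠ 0 := sub_ne_zero.2 hl
  set C := leadingCoeff m₁ m₂ A with hCdef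
  set S : ℂ → ℂ := fun t => Complex.exp (-(m₁ - m₂) * t) with hS
  have hS0 (t : ℂ) : S t ≠ 0 := Complex.exp_ne_zero _
  have hSlim : Tendsto S (logAtInfty M) (𝓝 0) :=
    tendsto_cexp_mul_logAtInfty (by simpa using hσ) M
  have l01 : Tendsto (fun t => Ψ t 0 1) (logAtInfty M) (𝓝 (A 0 1)) := by
    simpa [deltaUL] using tendsto_pi_nhds.1 (tendsto_pi_nhds.1 hδ 0) 1
  have l10 : Tendsto (fun t => Ψ t 1 0) (logAtInfty M) (𝓝 (A 1 0)) := by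
    simpa [deltaUL] using tendsto_pi_nhds.1 (tendsto_pi_nhds.1 hδ 1) 0
  have la := l01.mul l10
  have lb : Tendsto (fun t => S t * (Ψ t 0 2 * Ψ t 2 0)) (logAtInfty M) (𝓝 C) :=
    tendsto_exp_mul_col_mul_row hσ htr hdet hlim (by decide) (by decide)
  have lc : Tendsto (fun t => S t * (Ψ t 1 2 * Ψ t 2 1)) (logAtInfty M) (𝓝 (-C)) := by
    rw [hCdef, ← col_mul_row_one hne htr hdet]
    exact tendsto_exp_mul_col_mul_row hσ htr hdet hlim (by decide) (by decide)
  have lp : Tendsto (fun t => S t * (Ψ t 0 1 * Ψ t 1 2 * Ψ t 2 0)) (logAtInfty M)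
      (𝓝 ((m₂ - A 0 0) * C)) := by
    rw [hCdef, leadingCoeff, ← mul_assoc, ← apply_zero_one_mul_col hne htr hdet, mul_assoc]
    refine (l01.mul (tendsto_exp_mul_col_mul_row hσ htr hdet hlim (i := 1) (j := 0)
      (by decide) (by decide))).congr fun t => ?_
    simp only [hS]; ring
  have lq : Tendsto (fun t => S t * (Ψ t 0 2 * Ψ t 2 1 * Ψ t 1 0)) (logAtInfty M)
      (𝓝 ((m₁ - A 0 0) * C)) := by
    rw [hCdef, leadingCoeff, mul_left_comm, ← row_mul_apply_one_zero hne htr hdet, ← mul_assoc]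
    refine ((tendsto_exp_mul_col_mul_row hσ htr hdet hlim (i := 0) (j := 1)
      (by decide) (by decide)).mul l10).congr fun t => ?_
    simp only [hS]; ring
  have lD : Tendsto (fun t => harnadD l (Ψ t)) (logAtInfty M) (𝓝 ((l 1 - m₁) * (l 1 - m₂))) := by
    have : (l 1 - m₁) * (l 1 - m₂) = (l 1 - A 0 0) * (l 1 - A 1 1) - A 0 1 * A 1 0 := by
      linear_combination (l 1) * htr - hdet
    rw [this]
    refine (la.const_sub ((l 1 - A 0 0) * (l 1 - A 1 1))).congr' ?_
    filter_upwards [hdiag] with t ht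
    rw [harnadD, ht, ht]
  have hD : ∀ᶠ t in logAtInfty M, harnadD l (Ψ t) ≠ 0 := by
    by_cases h1 : l 1 = m₁
    · -- the limit of `D` vanishes, but `D` is of exact order `z₃^(σ - 1)` by its derivative
      have lE : Tendsto (fun t => Complex.exp t * (1 + Complex.exp t)⁻¹) (logAtInfty M) (𝓝 1) := by
        have h2 := ((tendsto_cexp_mul_logAtInfty (μ := -1) (by simp) M).add_const 1).inv₀ (by simp)
        rw [zero_add, inv_one] at h2
        refine h2.congr fun t => ?_
        have h3 := Complex.exp_ne_zero t
        rw [neg_one_mul, Complex.exp_neg, ← div_eq_mul_inv, ← inv_div, add_div, div_self h3, one_div,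
          add_comm]
      have hμ : (m₁ - m₂ - 1).re < 0 := by
        rw [Complex.sub_re, Complex.one_re]; linarith
      have hμ0 : m₁ - m₂ - 1 ≠ 0 := by intro h; rw [h] at hμ; simp at hμ
      have key := tendsto_exp_mul_of_hasDerivAt hμ (M := M)
        (h := fun t => (l 1 - A 0 0) * (l 1 - A 1 1) - Ψ t 0 1 * Ψ t 1 0)
        (hder.mono fun t h => h.const_sub _) ?_ (K := (m₁ - m₂) * C) ?_
      · have hK : (m₁ - m₂) * C / (m₁ - m₂ - 1) ≠ 0 :=
          div_ne_zero (mul_ne_zero (sub_ne_zero.2 hne) hC) hμ0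
        filter_upwards [key.eventually_ne hK, hdiag] with t h2 h3
        rw [harnadD, h3, h3]
        exact right_ne_zero_of_mul h2
      · rw [h1, sub_self, zero_mul] at lD
        refine lD.congr' ?_
        filter_upwards [hdiag] with t ht
        rw [harnadD, ht, ht]
      · have h2 := lE.mul (lq.sub lp)
        rw [one_mul, show (m₁ - A 0 0) * C - (m₂ - A 0 0) * C = (m₁ - m₂) * C by ring] at h2
        refine h2.congr fun t => ?_
        rw [show -(m₁ - m₂ - 1) * t = t + -(m₁ - m₂) * t by ring, Complex.exp_add]
        simp only [hS]
        ring
    · exact lD.eventually_ne (mul_ne_zero (sub_ne_zero.2 h1) hlm)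
  have lden : Tendsto (fun t => S t * (Ψ t 0 2 * Ψ t 2 1 * Ψ t 1 0) +
      (l 1 - A 1 1) * (S t * (Ψ t 0 2 * Ψ t 2 0))) (logAtInfty M) (𝓝 (C * (l 1 - m₂))) := by
    have := lq.add (lb.const_mul (l 1 - A 1 1))
    convert this using 2
    linear_combination C * htr
  have hden := lden.eventually_ne (mul_ne_zero hC hlm)
  have ladj : Tendsto (fun t => S t * ((l 1 - A 1 1) * (l 1 - A 2 2)) -
      S t * (Ψ t 1 2 * Ψ t 2 1)) (logAtInfty M) (𝓝 C) := by
    have := (hSlim.mul_const ((l 1 - A 1 1) * (l 1 - A 2 2))).sub lc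
    simpa using this
  have lv : Tendsto (fun t => S t * harnadV l (Ψ t)) (logAtInfty M) (𝓝 (C / (l 1 - m₂))) := by
    have h1 := (lb.mul ladj).div lden (mul_ne_zero hC hlm)
    rw [mul_div_mul_left _ _ hC] at h1
    refine h1.congr' ?_
    filter_upwards [hD, hden, hdiag, hchar] with t hD hden hdiag hchar
    obtain ⟨htr', hmin, hdet'⟩ := charpoly_relations hchar
    have hroot : (l 1 - Ψ t 0 0) * (l 1 - Ψ t 1 1) * (l 1 - Ψ t 2 2)
        - Ψ t 0 1 * Ψ t 1 0 * (l 1 - Ψ t 2 2) - Ψ t 0 2 * Ψ t 2 0 * (l 1 - Ψ t 1 1)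
        - Ψ t 1 2 * Ψ t 2 1 * (l 1 - Ψ t 0 0) - Ψ t 0 1 * Ψ t 1 2 * Ψ t 2 0
        - Ψ t 0 2 * Ψ t 2 1 * Ψ t 1 0 = 0 := by
      linear_combination (l 1) ^ 2 * htr' - l 1 * hmin + hdet'
    have hvdef : harnadV l (Ψ t) * harnadD l (Ψ t) = Ψ t 0 1 * Ψ t 1 2 * Ψ t 2 0 +
        (l 1 - Ψ t 1 1) * Ψ t 0 2 * Ψ t 2 0 := div_mul_cancel₀ _ hD
    simp only [Pi.div_apply]
    rw [div_eq_iff hden, ← hdiag, ← hdiag]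
    apply mul_right_cancel₀ hD
    have hDdef : harnadD l (Ψ t) =
      (l 1 - Ψ t 0 0) * (l 1 - Ψ t 1 1) - Ψ t 0 1 * Ψ t 1 0 := rfl
    linear_combination (-(S t) ^ 2 * (Ψ t 0 2 * Ψ t 2 1 * Ψ t 1 0
      + (l 1 - Ψ t 1 1) * (Ψ t 0 2 * Ψ t 2 0))) * hvdef
      + ((S t) ^ 2 * (Ψ t 0 2 * Ψ t 2 0) * (l 1 - Ψ t 1 1)) * hroot
      + ((S t) ^ 2 * (Ψ t 0 2 * Ψ t 2 0) * ((l 1 - Ψ t 1 1) * (l 1 - Ψ t 2 2)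
        - Ψ t 1 2 * Ψ t 2 1)) * hDdef
  have lV : Tendsto (fun t => S t * (l 2 - Ψ t 0 0 + harnadV l (Ψ t))) (logAtInfty M)
      (𝓝 (C / (l 1 - m₂))) := by
    have h1 := (hSlim.mul_const (l 2 - A 0 0)).add lv
    rw [zero_mul, zero_add] at h1
    refine h1.congr' ?_
    filter_upwards [hdiag] with t ht
    rw [ht, mul_add]
  have hCl := div_ne_zero hC hlm
  have hv := lv.eventually_ne hCl
  have hV := lV.eventually_ne hCl
  refine ⟨?_, ?_⟩
  · filter_upwards [hD, hv, hV] with t h1 h2 h3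
    exact ⟨h1, right_ne_zero_of_mul h2, right_ne_zero_of_mul h3⟩
  · have h1 := ((lv.const_mul (l 2 - A 2 2)).add lb).div (lv.mul lV) (mul_ne_zero hCl hCl)
    have e : ((l 2 - A 2 2) * (C / (l 1 - m₂)) + C) / (C / (l 1 - m₂) * (C / (l 1 - m₂))) =
        (l 1 - m₂) * (l 1 - m₂ + (l 2 - A 2 2)) / C := by
      field_simp; ring
    rw [e] at h1
    refine h1.congr' ?_
    filter_upwards [hv, hV, hdiag] with t h2 h3 hdiag
    have h2' := right_ne_zero_of_mul h2
    have h3' := right_ne_zero_of_mul h3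
    have h4 : Complex.exp ((m₁ - m₂) * t) = (S t)⁻¹ := by
      rw [hS, ← Complex.exp_neg]; congr 1; ring
    have h5 := hS0 t
    rw [h4, harnadR, ← hdiag 2]
    simp only [Pi.div_apply]
    generalize S t = s at *
    field_simp
    ring

/-! ### The coordinate `log x` -/

/-- The inverse of `logX`: the value of `log z₃` in terms of `ξ = log x`, as `z₃ = (1 - x)/x`. -/
noncomputable def logZ (ξ : ℂ) : ℂ := -ξ + Complex.log (1 - Complex.exp ξ)

theorem norm_exp_lt_one {ξ : ℂ} (h : ξ.re < 0) : ‖Complex.exp ξ‖ < 1 := by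
  rw [Complex.norm_exp]; exact Real.exp_lt_one_iff.2 h

theorem one_sub_exp_mem_slitPlane {ξ : ℂ} (h : ξ.re < 0) :
    1 - Complex.exp ξ ∈ Complex.slitPlane := by
  rw [sub_eq_add_neg]
  exact Complex.mem_slitPlane_of_norm_lt_one (by rw [norm_neg]; exact norm_exp_lt_one h)

theorem exp_neg_logZ {ξ : ℂ} (h : ξ.re < 0) :
    Complex.exp (-logZ ξ) = Complex.exp ξ / (1 - Complex.exp ξ) := by
  rw [logZ, neg_add, neg_neg, Complex.exp_add, Complex.exp_neg,
    Complex.exp_log (Complex.slitPlane_ne_zero (one_sub_exp_mem_slitPlane h)), div_eq_mul_inv]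

theorem exp_mul_one_add_exp_logZ {ξ : ℂ} (h : ξ.re < 0) :
    Complex.exp ξ * (1 + Complex.exp (logZ ξ)) = 1 := by
  have h1 := Complex.slitPlane_ne_zero (one_sub_exp_mem_slitPlane h)
  have h2 := Complex.exp_ne_zero ξ
  have h3 : Complex.exp (logZ ξ) = (1 - Complex.exp ξ) / Complex.exp ξ := by
    rw [← inv_inv (Complex.exp (logZ ξ)), ← Complex.exp_neg, exp_neg_logZ h, inv_div]
  rw [h3]; field_simp; ring

theorem logX_logZ (a b : ℂ) {ξ : ℂ} (h : ξ.re < 0) : logX ![a, b, logZ ξ] = ξ := by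
  have hs := one_sub_exp_mem_slitPlane h
  have h1 := Complex.slitPlane_ne_zero hs
  have h2 : 1 + Complex.exp (-logZ ξ) = (1 - Complex.exp ξ)⁻¹ := by
    rw [exp_neg_logZ h]; field_simp; ring
  simp only [logX, Matrix.cons_val]
  rw [h2, Complex.log_inv _ (Complex.mem_slitPlane_iff_arg.1 hs).1, logZ]
  ring

theorem IsIsomonodromySolutionOn.logZ_logX {ρ : ℝ → ℝ}
    {Φ : (Fin 3 → ℂ) → Matrix (Fin 3) (Fin 3) ℂ} (h : IsIsomonodromySolutionOn (logDomain ρ) Φ)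
    {ζ : Fin 3 → ℂ} (hζ : ζ ∈ logDomain ρ) : logZ (logX ζ) = ζ 2 := by
  have ht : ρ (ζ 2).im < (ζ 2).re := hζ
  have hs : 1 + Complex.exp (-ζ 2) ∈ Complex.slitPlane := by
    by_contra hn
    rw [Complex.mem_slitPlane_iff, not_or, not_lt, not_not] at hn
    obtain ⟨hre, him⟩ := hn
    -- otherwise `z₃ ∈ [-1, 0)`, and the ray from `log z₃` meets a point with `z₃ = -1`, where `u₃ = u₁`
    set r : ℝ := -(Complex.exp (-ζ 2)).re with hr
    have hr1 : 1 ≤ r := by simp at hre; linarith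
    have hexp : Complex.exp (-ζ 2) = -(r : ℂ) := by
      apply Complex.ext
      · simp [hr]
      · simpa using him
    have hpos : 0 < r := by linarith
    have hmem : ρ (ζ 2 + (Real.log r : ℝ)).im < (ζ 2 + (Real.log r : ℝ)).re := by
      have := Real.log_nonneg hr1
      simp only [Complex.add_im, Complex.ofReal_im, add_zero, Complex.add_re, Complex.ofReal_re]
      linarith
    apply h.one_add_exp_ne_zero hmem
    have h1 : Complex.exp (ζ 2) = (-(r : ℂ))⁻¹ := by
      rw [← hexp, ← Complex.exp_neg, neg_neg]
    rw [Complex.exp_add, h1, ← Complex.ofReal_exp, Real.exp_log hpos]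
    have : (r : ℂ) ≠ 0 := by exact_mod_cast hpos.ne'
    field_simp
    ring
  have h0 := Complex.slitPlane_ne_zero hs
  have h2 : 1 - Complex.exp (logX ζ) = (1 + Complex.exp (-ζ 2))⁻¹ := by
    rw [logX, Complex.exp_sub, Complex.exp_log h0]
    field_simp; ring
  rw [logZ, h2, Complex.log_inv _ (Complex.mem_slitPlane_iff_arg.1 hs).1, logX]
  ring

theorem hasDerivAt_logZ {ξ : ℂ} (h : ξ.re < 0) :
    HasDerivAt logZ (-(1 / (1 - Complex.exp ξ))) ξ := by
  have hs := one_sub_exp_mem_slitPlane h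
  have h1 := Complex.slitPlane_ne_zero hs
  have := (hasDerivAt_neg ξ).add (((Complex.hasDerivAt_exp ξ).const_sub 1).clog hs)
  refine this.congr_deriv ?_
  field_simp; ring

theorem eventually_logAtZero {M : ℝ} {p : ℂ → Prop} :
    (∀ᶠ t in logAtZero M, p t) ↔ ∃ T, ∀ t : ℂ, t.re ≤ T → |t.im| ≤ M → p t := by
  rw [logAtZero, eventually_inf_principal, eventually_comap, eventually_atBot]
  constructor
  · rintro ⟨T, h⟩; exact ⟨T, fun t h1 h2 => h _ h1 t rfl h2⟩
  · rintro ⟨T, h⟩; exact ⟨T, fun s h1 t ht h2 => h t (ht ▸ h1) h2⟩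

/-- A property of all points near `x = 0` in a wider sector holds in neighbourhoods of the points
of a sector. -/
theorem eventually_eventually_nhds_logAtZero {M : ℝ} {p : ℂ → Prop}
    (h : ∀ᶠ t in logAtZero (M + 1), p t) : ∀ᶠ t in logAtZero M, ∀ᶠ s in 𝓝 t, p s := by
  obtain ⟨T, hT⟩ := eventually_logAtZero.1 h
  refine eventually_logAtZero.2 ⟨T - 1, fun t h1 h2 => ?_⟩
  have e1 : ∀ᶠ s in 𝓝 t, s.re < T :=
    Complex.continuous_re.continuousAt.eventually_lt_const (by linarith)
  have e2 : ∀ᶠ s in 𝓝 t, |s.im| < M + 1 :=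
    Complex.continuous_im.abs.continuousAt.eventually_lt_const (by linarith)
  filter_upwards [e1, e2] with s h3 h4
  exact hT s h3.le h4.le

theorem tendsto_neg_logAtZero (M : ℝ) : Tendsto (fun ξ => -ξ) (logAtZero M) (logAtInfty M) := by
  refine tendsto_inf.2 ⟨tendsto_comap_iff.2 ?_, tendsto_principal.2 ?_⟩
  · exact tendsto_neg_atBot_atTop.comp (tendsto_comap.mono_left inf_le_left)
  · filter_upwards [mem_inf_of_right (mem_principal_self _)] with t ht
    simpa using ht

theorem tendsto_cexp_mul_logAtZero {μ : ℂ} (hμ : 0 < μ.re) (M : ℝ) :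
    Tendsto (fun t => Complex.exp (μ * t)) (logAtZero M) (𝓝 0) := by
  have := (tendsto_cexp_mul_logAtInfty (μ := -μ) (by simpa using hμ) M).comp
    (tendsto_neg_logAtZero M)
  simpa [Function.comp_def] using this

theorem tendsto_log_one_sub_exp (M : ℝ) :
    Tendsto (fun ξ => Complex.log (1 - Complex.exp ξ)) (logAtZero M) (𝓝 0) := by
  have h1 : Tendsto (fun ξ => 1 - Complex.exp ξ) (logAtZero M) (𝓝 1) := by
    simpa using (tendsto_cexp_mul_logAtZero (μ := 1) (by simp) M).const_sub 1
  have := (continuousAt_clog (x := 1) (by simp)).tendsto.comp h1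
  simpa [Function.comp_def] using this

theorem tendsto_logZ (M : ℝ) : Tendsto logZ (logAtZero M) (logAtInfty (M + 1)) := by
  have h1 : ∀ᶠ ξ in logAtZero M, ‖Complex.log (1 - Complex.exp ξ)‖ < 1 := by
    have := (tendsto_log_one_sub_exp M).norm
    rw [norm_zero] at this
    exact this.eventually_lt_const one_pos
  refine tendsto_inf.2 ⟨tendsto_comap_iff.2 ?_, tendsto_principal.2 ?_⟩
  · have h2 : Tendsto (fun ξ : ℂ => -ξ.re + -1) (logAtZero M) atTop :=
      tendsto_atTop_add_const_right _ _
        (tendsto_neg_atBot_atTop.comp (tendsto_comap.mono_left inf_le_left))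
    refine tendsto_atTop_mono' _ ?_ h2
    filter_upwards [h1] with ξ h
    have := (abs_le.1 (Complex.abs_re_le_norm (Complex.log (1 - Complex.exp ξ)))).1
    simp only [Function.comp, logZ, Complex.add_re, Complex.neg_re]
    linarith
  · filter_upwards [h1, mem_inf_of_right (mem_principal_self _)] with ξ h h2
    have := Complex.abs_im_le_norm (Complex.log (1 - Complex.exp ξ))
    simp only [logZ, Complex.add_im, Complex.neg_im] at h2 ⊢
    refine (abs_add_le _ _).trans ?_
    rw [abs_neg]
    linarith

theorem IsIsomonodromySolutionOn.hasDerivAt_logZ {ρ : ℝ → ℝ}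
    {Φ : (Fin 3 → ℂ) → Matrix (Fin 3) (Fin 3) ℂ} (h : IsIsomonodromySolutionOn (logDomain ρ) Φ)
    {ξ : ℂ} (hξ : ξ.re < 0) (hmem : ρ (logZ ξ).im < (logZ ξ).re) (i j : Fin 3) :
    HasDerivAt (fun η => Φ ![0, 0, logZ η] i j) (-(1 / (1 - Complex.exp ξ)) *
      comm (flowMatrix (Complex.exp ξ) (Φ ![0, 0, logZ ξ])) (Φ ![0, 0, logZ ξ]) i j) ξ := by
  refine ((h.hasDerivAt_two hmem (exp_mul_one_add_exp_logZ hξ) i j).comp ξ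
    (Isomonodromy.hasDerivAt_logZ hξ)).congr_deriv (mul_comm _ _)

/-! ### Conclusion -/

theorem eigenvalue_relations {A : Matrix (Fin 3) (Fin 3) ℂ} {m₁ m₂ : ℂ}
    (hm : (A.submatrix Fin.castSucc Fin.castSucc).charpoly =
      (Polynomial.X - Polynomial.C m₁) * (Polynomial.X - Polynomial.C m₂)) :
    A 0 0 + A 1 1 = m₁ + m₂ ∧ A 0 0 * A 1 1 - A 0 1 * A 1 0 = m₁ * m₂ := by
  have key (t : ℂ) : (t - m₁) * (t - m₂) = (t - A 0 0) * (t - A 1 1) - A 0 1 * A 1 0 := by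
    have := congrArg (Polynomial.eval t) hm
    rw [Matrix.eval_charpoly, Matrix.det_fin_two] at this
    simp at this
    linear_combination -this
  have h0 := key 0
  have h1 := key 1
  exact ⟨by linear_combination h1 - h0, by linear_combination -h0⟩

end Isomonodromy

open Isomonodromy Polynomial in
theorem proposition1p1
    (Φ₀ : Matrix (Fin 3) (Fin 3) ℂ) (ρ : ℝ → ℝ) (hρ : Continuous ρ)
    (Φ : (Fin 3 → ℂ) → Matrix (Fin 3) (Fin 3) ℂ)
    (hΦ : IsShrinkingSolution Φ₀ ρ Φ)
    -- `l 0, l 1, l 2` are the eigenvalues of the solution, in any order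
    (l : Fin 3 → ℂ)
    (hl : ∀ ζ ∈ logDomain ρ, (Φ ζ).charpoly = (X - C (l 0)) * (X - C (l 1)) * (X - C (l 2)))
    -- `m₁, m₂` are the eigenvalues of the upper left `2 × 2` block of `Φ₀`
    (m₁ m₂ σ : ℂ)
    (hm : (Φ₀.submatrix Fin.castSucc Fin.castSucc).charpoly = (X - C m₁) * (X - C m₂))
    (hσ : σ = m₁ - m₂) (hσ0 : 0 < σ.re)
    (θ₁ θ₂ θ₃ θinf : ℂ)
    (hθ₁ : θ₁ = l 2 - Φ₀ 0 0) (hθ₂ : θ₂ = l 2 - Φ₀ 1 1) (hθ₃ : θ₃ = l 2 - Φ₀ 2 2)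
    (hθinf : θinf = l 0 - l 1)
    (hσp : σ ≠ θinf + θ₃) (hσm : σ ≠ θinf - θ₃)
    (J : ℂ) (hJ0 : J ≠ 0)
    (hJ : (-θ₃ + θinf - σ) * (θ₃ + θinf - σ) * J =
      Φ₀ 0 2 * Φ₀ 2 0
      + 2 * (Φ₀ 0 2 * Φ₀ 2 1 * Φ₀ 1 0 - Φ₀ 0 1 * Φ₀ 1 2 * Φ₀ 2 0) / σ
      - ((Φ₀ 0 0 - Φ₀ 1 1) * Φ₀ 0 2 + 2 * Φ₀ 0 1 * Φ₀ 1 2)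
        * ((Φ₀ 0 0 - Φ₀ 1 1) * Φ₀ 2 0 + 2 * Φ₀ 2 1 * Φ₀ 1 0) / σ ^ 2) :
    ∃ Y : ℂ → ℂ,
      -- the expression for `y` is a function of `log x` alone
      (∀ ζ ∈ logDomain ρ, harnadY l (Φ ζ) (xOf ζ) = Y (logX ζ)) ∧
      -- near `x = 0` it is well defined and solves the sixth Painlevé equation
      (∀ M : ℝ, ∀ᶠ ξ in logAtZero M,
        (∃ ζ ∈ logDomain ρ, logX ζ = ξ) ∧
        (∀ ζ ∈ logDomain ρ, logX ζ = ξ → HarnadDefined l (Φ ζ) (xOf ζ)) ∧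
        IsPainleveSixAt ((θinf - 1) ^ 2 / 2) (-θ₁ ^ 2 / 2) (θ₃ ^ 2 / 2) ((1 - θ₂ ^ 2) / 2) Y ξ) ∧
      -- `y(x) = J x^{1-σ} + o(x^{1-σ})` as `x → 0` in every sector
      (∀ M : ℝ, (fun ξ => Y ξ - J * Complex.exp ((1 - σ) * ξ))
        =o[logAtZero M] fun ξ => Complex.exp ((1 - σ) * ξ)) := by
  subst hσ
  have hsol := hΦ.solution
  obtain ⟨hshape, hdiag, hlim⟩ := hΦ.reduction hρ
  obtain ⟨htr, hdet⟩ := eigenvalue_relations hm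
  have hne : m₁ ≠ m₂ := by rintro rfl; simp at hσ0
  have hσ1 : (m₁ - m₂).re < 1 := by
    have hmon := (Φ₀.submatrix Fin.castSucc Fin.castSucc).charpoly_monic.ne_zero
    refine (abs_lt.1 (hΦ.boundary m₁ ?_ m₂ ?_)).2 <;>
      rw [mem_roots hmon, hm] <;> simp
  -- by the trace, the conditions on `σ` say that the two factors in front of `J` do not vanish
  have htrace : l 0 + l 1 + l 2 = Φ₀ 0 0 + Φ₀ 1 1 + Φ₀ 2 2 := by
    have hmem : ρ (ρ 0 + 1 : ℂ).im < (ρ 0 + 1 : ℂ).re := by simp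
    have := (charpoly_relations (hl ![0, 0, ρ 0 + 1] hmem)).1
    rwa [hdiag _ hmem, hdiag _ hmem, hdiag _ hmem] at this
  have hp : -θ₃ + θinf - (m₁ - m₂) = -2 * (l 1 - m₂ + (l 2 - Φ₀ 2 2)) := by
    rw [hθ₃, hθinf]; linear_combination htrace + htr
  have hq : θ₃ + θinf - (m₁ - m₂) = -2 * (l 1 - m₂) := by
    rw [hθ₃, hθinf]; linear_combination htrace + htr
  have hl1 : l 1 - m₂ ≠ 0 := fun h => hσp (by linear_combination 2 * h - hq)
  have hl2 : l 1 - m₂ + (l 2 - Φ₀ 2 2) ≠ 0 := fun h => hσm (by linear_combination 2 * h - hp)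
  rw [← four_mul_leadingCoeff hne htr, hp, hq] at hJ
  have hJC : (l 1 - m₂) * (l 1 - m₂ + (l 2 - Φ₀ 2 2)) * J = leadingCoeff m₁ m₂ Φ₀ := by
    linear_combination hJ / 4
  have hC : leadingCoeff m₁ m₂ Φ₀ ≠ 0 := by
    rw [← hJC]; exact mul_ne_zero (mul_ne_zero hl1 hl2) hJ0
  have hJinv : (l 1 - m₂) * (l 1 - m₂ + (l 2 - Φ₀ 2 2)) / leadingCoeff m₁ m₂ Φ₀ = J⁻¹ := by
    rw [← hJC]; field_simp
  set Ψ : ℂ → Matrix (Fin 3) (Fin 3) ℂ := fun t => Φ ![0, 0, t] with hΨ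
  have hasym (M : ℝ) := tendsto_harnad (Ψ := Ψ) (M := M) (l := l) hσ0 hσ1 htr hdet (hlim M).1
    (hlim M).2 ((eventually_lt_re_logAtInfty hρ M).mono fun t ht i => hdiag t ht i)
    ((eventually_lt_re_logAtInfty hρ M).mono fun t ht => by
      have hx := inv_mul_cancel₀ (hsol.one_add_exp_ne_zero ht)
      have h01 := hsol.hasDerivAt_two ht hx 0 1
      have h10 := hsol.hasDerivAt_two ht hx 1 0
      rw [comm_flowMatrix] at h01 h10
      refine (h01.mul h10).congr_deriv ?_
      simp [hΨ]; ring)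
    ((eventually_lt_re_logAtInfty hρ M).mono fun t ht => hl _ ht) hC (sub_ne_zero.1 hl1)
  simp only [hJinv] at hasym
  set Y : ℂ → ℂ := fun ξ => harnadY l (Ψ (logZ ξ)) (Complex.exp ξ) with hY
  have hx0 (M : ℝ) : Tendsto Complex.exp (logAtZero M) (𝓝 0) := by
    simpa using tendsto_cexp_mul_logAtZero (μ := 1) (by simp) M
  have hxσ (M : ℝ) : Tendsto (fun ξ => Complex.exp ((1 - (m₁ - m₂)) * ξ)) (logAtZero M) (𝓝 0) :=
    tendsto_cexp_mul_logAtZero (by rw [Complex.sub_re, Complex.one_re]; linarith) M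
  -- `x + (1 - x) R = x^σ E` with `E → 1/J`
  set E : ℂ → ℂ := fun ξ => Complex.exp ((1 - (m₁ - m₂)) * ξ) + (1 - Complex.exp ξ) *
    (Complex.exp (-(m₁ - m₂) * ξ) * harnadR l (Ψ (logZ ξ))) with hE
  have hEeq (ξ : ℂ) : Complex.exp ξ + (1 - Complex.exp ξ) * harnadR l (Ψ (logZ ξ)) =
      Complex.exp ((m₁ - m₂) * ξ) * E ξ := by
    have h1 : Complex.exp ((m₁ - m₂) * ξ) * Complex.exp ((1 - (m₁ - m₂)) * ξ) =
        Complex.exp ξ := by rw [← Complex.exp_add]; congr 1; ring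
    have h2 : Complex.exp ((m₁ - m₂) * ξ) * Complex.exp (-(m₁ - m₂) * ξ) = 1 := by
      rw [← Complex.exp_add, ← Complex.exp_zero]; congr 1; ring
    simp only [hE]
    linear_combination -h1 - (1 - Complex.exp ξ) * harnadR l (Ψ (logZ ξ)) * h2
  have hElim (M : ℝ) : Tendsto E (logAtZero M) (𝓝 J⁻¹) := by
    have h1 := (hasym (M + 1)).2.comp (tendsto_logZ M)
    have h2 : Tendsto (fun ξ => Complex.exp (-(m₁ - m₂) * Complex.log (1 - Complex.exp ξ)))
        (logAtZero M) (𝓝 1) := by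
      have := ((tendsto_log_one_sub_exp M).const_mul (-(m₁ - m₂))).cexp
      simpa using this
    have h3 := (hxσ M).add (((hx0 M).const_sub 1).mul (h2.mul h1))
    simp only [sub_zero, one_mul, zero_add] at h3
    refine h3.congr fun ξ => ?_
    simp only [hE, Function.comp, ← mul_assoc, ← Complex.exp_add]
    congr 4
    rw [logZ]; ring
  have hYE (ξ : ℂ) : Y ξ = Complex.exp ((1 - (m₁ - m₂)) * ξ) * (E ξ)⁻¹ := by
    have h1 : Complex.exp ((1 - (m₁ - m₂)) * ξ) = Complex.exp ξ / Complex.exp ((m₁ - m₂) * ξ) := by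
      rw [← Complex.exp_sub]; congr 1; ring
    simp only [hY, harnadY]
    rw [hEeq, h1, div_mul_eq_div_div, div_eq_mul_inv _ (E ξ)]
  have hEinv (M : ℝ) : Tendsto (fun ξ => (E ξ)⁻¹) (logAtZero M) (𝓝 J) := by
    simpa using (hElim M).inv₀ (inv_ne_zero hJ0)
  have hgood (M : ℝ) : ∀ᶠ ξ in logAtZero M, ξ.re < 0 ∧ ρ (logZ ξ).im < (logZ ξ).re ∧
      HarnadDefined l (Ψ (logZ ξ)) (Complex.exp ξ) ∧ Y ξ ≠ 1 ∧ Y ξ ≠ Complex.exp ξ := by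
    have h1 : ∀ᶠ ξ in logAtZero M, ξ.re < 0 := eventually_logAtZero.2
      ⟨-1, fun t h _ => by linarith⟩
    have h2 := (tendsto_logZ M).eventually (eventually_lt_re_logAtInfty hρ (M + 1))
    have h3 := (tendsto_logZ M).eventually (hasym (M + 1)).1
    have h4 := (hElim M).eventually_ne (inv_ne_zero hJ0)
    have h5 : ∀ᶠ ξ in logAtZero M, Y ξ ≠ 1 := by
      have := (hxσ M).mul (hEinv M)
      rw [zero_mul] at this
      exact (this.congr fun ξ => (hYE ξ).symm).eventually_ne zero_ne_one
    have h6 : ∀ᶠ ξ in logAtZero M, Complex.exp ((m₁ - m₂) * ξ) * E ξ ≠ 1 := by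
      have := (tendsto_cexp_mul_logAtZero hσ0 M).mul (hElim M)
      rw [zero_mul] at this
      exact this.eventually_ne zero_ne_one
    filter_upwards [h1, h2, h3, h4, h5, h6] with ξ h1 h2 h3 h4 h5 h6
    refine ⟨h1, h2, ⟨h3.1, h3.2.1, h3.2.2, ?_⟩, h5, fun h => h6 ?_⟩
    · rw [hEeq]
      exact mul_ne_zero (Complex.exp_ne_zero _) h4
    · have hx := Complex.exp_ne_zero ξ
      have h7 : Complex.exp ((m₁ - m₂) * ξ) * E ξ ≠ 0 := mul_ne_zero (Complex.exp_ne_zero _) h4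
      simp only [hY, harnadY] at h
      rw [hEeq, div_eq_iff h7] at h
      exact mul_left_cancel₀ hx (by rw [← h, mul_one])
  have hreduce (ζ : Fin 3 → ℂ) (hζ : ζ ∈ logDomain ρ) :
      Φ ζ = expAd (-(ζ 0 + ζ 1)) (Matrix.diagonal fun i => Φ₀ i i) (Ψ (ζ 2)) := by
    have h1 := hshape (ζ 0) (ζ 1) (ζ 2) hζ
    have h2 : ![ζ 0, ζ 1, ζ 2] = ζ := by
      ext i; fin_cases i <;> rfl
    rwa [h2] at h1
  refine ⟨Y, fun ζ hζ => ?_, fun M => ?_, fun M => ?_⟩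
  · simp only [hY]
    rw [hreduce ζ hζ, harnadY_expAd_diagonal, hsol.logZ_logX hζ, exp_logX ζ (hsol ζ hζ).1]
  · filter_upwards [hgood M, eventually_eventually_nhds_logAtZero (hgood (M + 1))]
      with ξ ⟨hre, hmem, hdef, hY1, hYx⟩ hnear
    refine ⟨⟨![0, 0, logZ ξ], hmem, logX_logZ 0 0 hre⟩, fun ζ hζ hζξ => ?_, ?_⟩
    · rw [hreduce ζ hζ, harnadDefined_expAd_diagonal, ← hsol.logZ_logX hζ,
        ← exp_logX ζ (hsol ζ hζ).1, hζξ]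
      exact hdef
    · have hx1 (η : ℂ) (h : η.re < 0) : Complex.exp η ≠ 1 := fun h1 => by
        have := norm_exp_lt_one h
        rw [h1, norm_one] at this
        exact lt_irrefl _ this
      have hder (η : ℂ) (hre : η.re < 0) (hmem : ρ (logZ η).im < (logZ η).re)
          (hdef : HarnadDefined l (Ψ (logZ η)) (Complex.exp η)) (hYx : Y η ≠ Complex.exp η) :=
        hasDerivAt_harnad (A := fun η => Ψ (logZ η)) (fun i j => hsol.hasDerivAt_logZ hre hmem i j)
          (hl _ hmem) (hx1 η hre) hdef hYx rfl hθinf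
      simp only [hΨ] at hder
      have hY0 : Y ξ ≠ 0 := div_ne_zero (Complex.exp_ne_zero _) hdef.2.2.2
      refine isPainleveSixAt_of_velocity (V := fun η => l 2 - Ψ (logZ η) 0 0 + harnadV l (Ψ (logZ η)))
        (n := l 1 - Φ₀ 0 0 + (l 2 - Φ₀ 2 2)) ?_ (hx1 ξ hre) hY0 hY1 hYx ?_ ?_
      · rw [hθ₁, hθ₂, hθ₃, hθinf]; linear_combination htrace
      · filter_upwards [hnear] with η ⟨hre, hmem, hdef, hY1, hYx⟩
        have := (hder η hre hmem hdef hYx).2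
        rw [hdiag _ hmem, hdiag _ hmem, ← hθ₁, ← hθ₃] at this
        simp only [hΨ]
        rw [hdiag _ hmem, ← hθ₁]
        exact this
      · have := (hder ξ hre hmem hdef hYx).1
        rw [hdiag _ hmem, hdiag _ hmem, hdiag _ hmem, ← hθ₁, ← hθ₂] at this
        simp only [hΨ]
        rw [hdiag _ hmem, ← hθ₁]
        exact this
  · have h1 : Tendsto (fun ξ => (E ξ)⁻¹ - J) (logAtZero M) (𝓝 0) := by
      simpa using (hEinv M).sub_const J
    have h2 := (isBigO_refl (fun ξ => Complex.exp ((1 - (m₁ - m₂)) * ξ))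
      (logAtZero M)).mul_isLittleO ((isLittleO_one_iff ℂ).2 h1)
    refine h2.congr (fun ξ => ?_) (fun ξ => mul_one _)
    rw [hYE]; ring
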